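/- \textbf{Setting.} Let $m\ge 1$ be an integer and $n=2m$. Let $x=(x_t)_{t\in\mathbb Z}$ be a complex sequence, $\sigma>0$, and let $y_\tau=x_\tau+\sigma\zeta_\tau$, $-n\le\tau\le n$, where the $\zeta_\tau$ are i.i.d. standard complex Gaussian, i.e. $\zeta_\tau=\xi^1_\tau+i\xi^2_\tau$ with $\xi^1_\tau,\xi^2_\tau$ independent $\mathcal N(0,1)$. For a filter $\varphi$ supported on $\{0,\dots,k\}$ put $[\varphi*u]_t=\sum_{j=0}^{k}\varphi_j u_{t-j}$. Write $\|u\|_{n,2}=\big(\sum_{t=0}^n|u_t|^2\big)^{1/2}$, and for $\varphi$ supported on $\{0,\dots,n\}$ write $\|\varphi\|^*_{n,1}=\sum_{k=0}^n\big|(n+1)^{-1/2}\sum_{t=0}^n\varphi_t e^{2\pi i kt/(n+1)}\big|$. For $\overline\varrho>0$ the \emph{constrained recovery} is $[\widehat x_{\rm con}]_t=[\widehat\varphi*y]_t$, $0\le t\le n$, where $\widehat\varphi$ is an optimal solution of $$\min_{\varphi\ \text{supported on}\ \{0,\dots,n\}}\Big\{\|y-\varphi*y\|_{n,2}:\ \|\varphi\|^*_{n,1}\le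 \overline\varrho/\sqrt{n+1}\Big\}.$$ The signal $x$ is \emph{$(m,\rho)$-simple} ($\rho\ge1$) if there is a (deterministic) filter $\phi^o$ supported on $\{0,\dots,m\}$ with $\big[\mathbf E|x_\tau-[\phi^o*y]_\tau|^2\big]^{1/2}\le \sigma\rho/\sqrt{m+1}$ for all $-m\le\tau\le 2m$. \emph{Assumption A} (with parameters $s,\varkappa$): $x=x^{\mathcal S}+\varepsilon$ with $x^{\mathcal S}\in\mathcal S$, where $\mathcal S\subset\mathbb C^{\mathbb Z}$ is a linear subspace of dimension $s$, $1\le s\le n+1$, with $\Delta\mathcal S=\mathcal S$ for the shift $[\Delta u]_t=u_{t-1}$, and $\|\Delta^\tau\varepsilon\|_{n,2}\le\sigma\varkappa$ for $0\le\tau\le n$. \textbf{Theorem (pointwise risk bound).} There is an absolute constant $C>0$ such that the following holds. Let $m\ge1$, $n=2m$, $\sigma>0$, $\rho\ge1$, let $x$ be $(m,\rho)$-simple, let Assumption A hold for some $s\in\mathbb Z_+$ and $\varkappa<\infty$, and let $\overline\varrho=2\rho^2$. Then optimal solutions $\widehat\varphi$ exist, and for every $0<\alpha\le1$, with probability at least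 $1-\alpha$, for every optimal solution $\widehat\varphi$ the corresponding constrained recovery satisfies $$\big|x_n-[\widehat x_{\rm con}]_n\big|\le C\,\frac{\sigma\rho}{\sqrt{m+1}}\left[\rho^2\sqrt{\ln(n/\alpha)}+\rho\sqrt{\varkappa\sqrt{\ln\max\{1/\alpha,\,2\}}}+\sqrt s\right].$$ (For $\alpha\le 1/2$ the middle term is $\rho\sqrt{\varkappa\sqrt{\ln(1/\alpha)}}$.) -/

import Mathlib

open MeasureTheory ProbabilityTheory

noncomputable section

namespace FilterRecovery

/-- The law of a standard complex Gaussian variable in the convention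
`ξ₁ + i ξ₂` with `ξ₁, ξ₂` independent real standard normal (so `E|ζ|² = 2`). -/
def stdComplexGaussian : Measure ℂ :=
  ((gaussianReal 0 1).prod (gaussianReal 0 1)).map (fun p : ℝ × ℝ => (⟨p.1, p.2⟩ : ℂ))

/-- The noise variables `ζ_τ`, `-n ≤ τ ≤ n`, are i.i.d. standard complex Gaussian.
Values of `ζ` at other indices are never used. -/
structure IsNoise {Ω : Type*} [MeasurableSpace Ω] (μ : Measure Ω) (n : ℕ) (ζ : ℤ → Ω → ℂ) :
    Prop where
  measurable : ∀ τ ∈ Set.Icc (-(n : ℤ)) n, Measurable (ζ τ)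
  law : ∀ τ ∈ Set.Icc (-(n : ℤ)) n, μ.map (ζ τ) = stdComplexGaussian
  indep : iIndepFun (fun (τ : Set.Icc (-(n : ℤ)) n) => ζ τ) μ

/-- The observations `y_τ = x_τ + σ ζ_τ`. -/
def obs {Ω : Type*} (x : ℤ → ℂ) (σ : ℝ) (ζ : ℤ → Ω → ℂ) (ω : Ω) : ℤ → ℂ :=
  fun τ => x τ + (σ : ℂ) * ζ τ ω

/-- The convolution `[φ * u]_t = ∑_{j=0}^{k} φ_j u_{t-j}` of a filter `φ` supported on `[0, k]`
(identified with a vector of length `k + 1`) with a two-sided sequence `u`. -/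
def conv {k : ℕ} (φ : Fin (k + 1) → ℂ) (u : ℤ → ℂ) : ℤ → ℂ :=
  fun t => ∑ j : Fin (k + 1), φ j * u (t - (j : ℕ))

/-- The unitary discrete Fourier transform on `ℂ^{n+1}`. -/
def dft {n : ℕ} (z : Fin (n + 1) → ℂ) : Fin (n + 1) → ℂ :=
  fun k => ((1 / Real.sqrt ((n : ℝ) + 1) : ℝ) : ℂ) *
    ∑ t : Fin (n + 1),
      z t * Complex.exp (2 * Real.pi * Complex.I * ((k : ℕ) : ℂ) * ((t : ℕ) : ℂ) / ((n : ℂ) + 1))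

/-- The `ℓ₁`-norm in the spectral domain, `‖φ‖*_{n,1} = ‖F_n φ‖₁`. -/
def specNorm1 {n : ℕ} (φ : Fin (n + 1) → ℂ) : ℝ :=
  ∑ k : Fin (n + 1), ‖dft φ k‖

/-- `‖u‖_{n,2} = (∑_{t=0}^n |u_t|²)^{1/2}`. -/
def norm2 (n : ℕ) (u : ℤ → ℂ) : ℝ :=
  Real.sqrt (∑ t ∈ Finset.range (n + 1), ‖u (t : ℤ)‖ ^ 2)

/-- `φ` is an optimal solution of the problem of minimizing `‖y - ψ * y‖_{n,2}` over filters `ψ`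
supported on `[0, n]` with `‖ψ‖*_{n,1} ≤ r / √(n+1)`. -/
def IsConstrainedOptimal (n : ℕ) (r : ℝ) (y : ℤ → ℂ) (φ : Fin (n + 1) → ℂ) : Prop :=
  specNorm1 φ ≤ r / Real.sqrt ((n : ℝ) + 1) ∧
    ∀ ψ : Fin (n + 1) → ℂ, specNorm1 ψ ≤ r / Real.sqrt ((n : ℝ) + 1) →
      norm2 n (y - conv φ y) ≤ norm2 n (y - conv ψ y)

/-- The signal `x` is `(m, ρ)`-simple at noise level `σ`: some filter supported on `[0, m]`
recovers `x_τ` from the noisy observations with root mean squared error at most `σρ/√(m+1)`,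
for all `-m ≤ τ ≤ 2m`. -/
def IsSimple {Ω : Type*} [MeasurableSpace Ω] (μ : Measure Ω) (ζ : ℤ → Ω → ℂ) (σ : ℝ)
    (m : ℕ) (ρ : ℝ) (x : ℤ → ℂ) : Prop :=
  ∃ φ : Fin (m + 1) → ℂ, ∀ τ ∈ Set.Icc (-(m : ℤ)) (2 * m),
    Real.sqrt (∫ ω, ‖x τ - conv φ (obs x σ ζ ω) τ‖ ^ 2 ∂μ) ≤ σ * ρ / Real.sqrt ((m : ℝ) + 1)

/-- The right shift `[Δ x]_t = x_{t-1}`. -/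
def shift : (ℤ → ℂ) →ₗ[ℂ] (ℤ → ℂ) where
  toFun x := fun t => x (t - 1)
  map_add' _ _ := rfl
  map_smul' _ _ := rfl

/-- Assumption A: `x = x^S + ε` with `x^S` in a shift-invariant subspace `S` (`Δ S = S`) of
dimension `s`, `1 ≤ s ≤ n + 1`, and `‖Δ^τ ε‖_{n,2} ≤ σ ϰ` for `0 ≤ τ ≤ n`. -/
def AssumptionA (n s : ℕ) (σ ϰ : ℝ) (x : ℤ → ℂ) : Prop :=
  1 ≤ s ∧ s ≤ n + 1 ∧
    ∃ S : Submodule ℂ (ℤ → ℂ), S.map shift = S ∧ Module.finrank ℂ S = s ∧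
      ∃ xS ∈ S, ∃ ε : ℤ → ℂ, x = xS + ε ∧
        ∀ τ : ℕ, τ ≤ n → norm2 n ((shift ^ τ) ε) ≤ σ * ϰ

end FilterRecovery

end

open MeasureTheory ProbabilityTheory

noncomputable section

namespace FilterRecovery

/-! ### Exponential moments of squared norms, and rotation invariance of Gaussian pairs. -/

section StdGaussian

open scoped RealInnerProductSpace

variable {E : Type*} [NormedAddCommGroup E] [InnerProductSpace ℝ E] [FiniteDimensional ℝ E]
  [MeasurableSpace E] [BorelSpace E]
variable {F : Type*} [NormedAddCommGroup F] [InnerProductSpace ℝ F] [FiniteDimensional ℝ F]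
  [MeasurableSpace F] [BorelSpace F]

/-! Let ζ be the noise, φ the filter given by simplicity, ψ an optimal filter, n = 2m, and Q the
bracket in the bound (`riskFactor`). Since the mean squared error of φ is squared bias plus
variance, `IsSimple.exists_filter` bounds both |x - φ * x| on [-m, 2m] and ‖φ‖₂² ≤ ρ²/(2(m+1)).

The comparison filter is φ * φ. Its transform is √(n+1) times the square of that of φ, so by
Parseval its spectral ℓ₁ norm is √(n+1)‖φ‖₂² (`specNorm1_convSq`), which makes it feasible. It
almost reproduces x because 1 - φ² = (1 - φ) + φ(1 - φ).

Optimality gives ‖y - ψ * y‖ ≤ ‖y - φ * φ * y‖. Expanding the squares bounds ‖x - ψ * x‖₂ by a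
multiple of σQ (`norm_le_of_residual_le`), provided the noise cross terms are controlled even though
ψ depends on the noise. Terms involving ψ * ζ are linear in ψ, and the feasible ball is generated by
n+1 Fourier atoms, so bounds for the atoms suffice (`norm_apply_le_specNorm1_mul`). For ⟨ζ, x - ψ *
x⟩, shift invariance keeps x^S - ψ * x^S in S whatever ψ is. That part therefore sees only the
projection of the noise onto a space of dimension at most s. The ε part is separated from ψ by
Cauchy–Schwarz.

The passage from ℓ₂ to a point rests on commuting convolutions: at time n, x - ψ * y = φ * (x - ψ *
x) + (1 - ψ) * (x - φ * x) - σ ψ * ζ. The first term is at most ‖φ‖₂‖x - ψ * x‖₂, the second is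
small by simplicity, and the third by the atom bounds (`norm_error_le_of_good_noise`).

The probabilistic input is Chernoff's bound, fed by exponential moments of squared contractions
(`lintegral_exp_sq_contraction`), of averages of such squares (`lintegral_exp_sum_sq`), and of
quadratic forms via decoupling (`lintegral_exp_quadratic`). Six events of failure probability at
most α/6 are intersected in `exists_event_risk_bound`. -/

lemma stdGaussian_map_inner (a : E) :
    (stdGaussian E).map (fun z => ⟪a, z⟫) = gaussianReal 0 (‖a‖₊ ^ 2) := by
  have h := IsGaussian.map_eq_gaussianReal (μ := stdGaussian E) (innerSL ℝ a)
  rw [integral_strongDual_stdGaussian, variance_dual_stdGaussian, innerSL_apply_norm] at h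
  have e : (‖a‖ ^ 2).toNNReal = ‖a‖₊ ^ 2 := by
    ext; simp
  rw [e] at h
  exact h

lemma lintegral_exp_inner (a : E) :
    ∫⁻ z, ENNReal.ofReal (Real.exp ⟪a, z⟫) ∂(stdGaussian E)
      = ENNReal.ofReal (Real.exp (‖a‖ ^ 2 / 2)) := by
  have hm : Measurable (fun z : E => ⟪a, z⟫) := by fun_prop
  have h1 : ∫⁻ z, ENNReal.ofReal (Real.exp ⟪a, z⟫) ∂(stdGaussian E)
      = ∫⁻ x, ENNReal.ofReal (Real.exp x) ∂(gaussianReal 0 (‖a‖₊ ^ 2)) := by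
    rw [← stdGaussian_map_inner, lintegral_map (by fun_prop) hm]
  have hi := integrable_exp_mul_gaussianReal (μ := 0) (v := ‖a‖₊ ^ 2) 1
  simp only [one_mul] at hi
  rw [h1, ← ofReal_integral_eq_lintegral_ofReal hi (Filter.Eventually.of_forall
    fun x => (Real.exp_pos x).le)]
  have := congrFun (mgf_id_gaussianReal (μ := 0) (v := ‖a‖₊ ^ 2)) 1
  simp only [mgf, id, one_mul] at this
  rw [this]
  simp

lemma lintegral_exp_sq_gaussianReal :
    ∫⁻ x, ENNReal.ofReal (Real.exp (x ^ 2 / 4)) ∂(gaussianReal 0 1)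
      = ENNReal.ofReal (Real.sqrt 2) := by
  rw [gaussianReal_of_var_ne_zero _ one_ne_zero,
    lintegral_withDensity_eq_lintegral_mul _ (measurable_gaussianPDF _ _) (by fun_prop)]
  have h : ∀ x : ℝ, (gaussianPDF 0 1 * fun x => ENNReal.ofReal (Real.exp (x ^ 2 / 4))) x
      = ENNReal.ofReal ((Real.sqrt (2 * Real.pi))⁻¹ * Real.exp (-(1 / 4) * x ^ 2)) := by
    intro x
    simp only [Pi.mul_apply, gaussianPDF, gaussianPDFReal]
    rw [← ENNReal.ofReal_mul (by positivity)]
    simp only [NNReal.coe_one, mul_one, sub_zero]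
    rw [mul_assoc, ← Real.exp_add]
    congr 3
    ring
  simp_rw [h]
  have hi : Integrable (fun x : ℝ => (Real.sqrt (2 * Real.pi))⁻¹ * Real.exp (-(1 / 4) * x ^ 2)) :=
    (integrable_exp_neg_mul_sq (by norm_num)).const_mul _
  rw [← ofReal_integral_eq_lintegral_ofReal hi (Filter.Eventually.of_forall
    fun x => by positivity), integral_const_mul, integral_gaussian]
  congr 1
  rw [← Real.sqrt_inv, ← Real.sqrt_mul (by positivity)]
  congr 1
  field_simp
  norm_num

lemma lintegral_exp_sq_stdGaussian :
    ∫⁻ g, ENNReal.ofReal (Real.exp (‖g‖ ^ 2 / 4)) ∂(stdGaussian F)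
      = ENNReal.ofReal (Real.sqrt 2 ^ Module.finrank ℝ F) := by
  rw [stdGaussian, lintegral_map (by fun_prop) (by fun_prop)]
  have h : ∀ x : Fin (Module.finrank ℝ F) → ℝ,
      ENNReal.ofReal (Real.exp (‖∑ i, x i • stdOrthonormalBasis ℝ F i‖ ^ 2 / 4))
        = ∏ i, ENNReal.ofReal (Real.exp (x i ^ 2 / 4)) := by
    intro x
    rw [← ENNReal.ofReal_prod_of_nonneg (fun i _ => (Real.exp_pos _).le), ← Real.exp_sum,
      ← Finset.sum_div]
    congr 3
    rw [← (stdOrthonormalBasis ℝ F).sum_sq_norm_inner_right]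
    refine Finset.sum_congr rfl fun i _ => ?_
    rw [(stdOrthonormalBasis ℝ F).orthonormal.inner_right_fintype]
    simp
  simp_rw [h]
  have hind : iIndepFun (fun (i : Fin (Module.finrank ℝ F)) (x : Fin (Module.finrank ℝ F) → ℝ) =>
      ENNReal.ofReal (Real.exp (x i ^ 2 / 4))) (Measure.pi fun _ => gaussianReal 0 1) :=
    iIndepFun_pi (X := fun _ (x : ℝ) => ENNReal.ofReal (Real.exp (x ^ 2 / 4)))
      (fun i => by fun_prop)
  rw [lintegral_prod_eq_prod_lintegral_of_indepFun Finset.univ _ hind (fun i => by fun_prop)]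
  have h2 : ∀ i : Fin (Module.finrank ℝ F),
      ∫⁻ x : Fin (Module.finrank ℝ F) → ℝ, ENNReal.ofReal (Real.exp (x i ^ 2 / 4))
        ∂(Measure.pi fun _ => gaussianReal 0 1) = ENNReal.ofReal (Real.sqrt 2) := by
    intro i
    rw [← lintegral_exp_sq_gaussianReal]
    exact (measurePreserving_eval (fun _ : Fin (Module.finrank ℝ F) => gaussianReal 0 1)
      i).lintegral_comp (f := fun x => ENNReal.ofReal (Real.exp (x ^ 2 / 4))) (by fun_prop)
  simp_rw [h2]
  rw [Finset.prod_const, Finset.card_univ, Fintype.card_fin, ENNReal.ofReal_pow (by positivity)]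

/-- Exponential moment of the squared norm of a contraction of a standard Gaussian vector. -/
lemma lintegral_exp_sq_contraction (S : E →L[ℝ] F) (hS : ∀ z, ‖S z‖ ≤ ‖z‖) :
    ∫⁻ z, ENNReal.ofReal (Real.exp (‖S z‖ ^ 2 / 4)) ∂(stdGaussian E)
      ≤ ENNReal.ofReal (Real.sqrt 2 ^ Module.finrank ℝ F) := by
  set t : ℝ := (Real.sqrt 2)⁻¹ with ht
  have ht2 : t ^ 2 = 1 / 2 := by
    rw [ht, inv_pow, Real.sq_sqrt (by norm_num)]; norm_num
  have hadj : ∀ g, ‖ContinuousLinearMap.adjoint S g‖ ≤ ‖g‖ := by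
    intro g
    refine ((ContinuousLinearMap.adjoint S).le_opNorm g).trans ?_
    rw [LinearIsometryEquiv.norm_map]
    have : ‖S‖ ≤ 1 := ContinuousLinearMap.opNorm_le_bound _ zero_le_one (by simpa using hS)
    nlinarith [norm_nonneg g]
  -- Linearization: with t² = 1/2 the exponential of the square is the average of exp ⟨t S z, g⟩
  -- over an independent Gaussian g. After exchanging the integrals, S acts on g through its
  -- adjoint, again a contraction, so the bound depends only on the dimension of the target.
  have h1 : ∀ z, ENNReal.ofReal (Real.exp (‖S z‖ ^ 2 / 4))
      = ∫⁻ g, ENNReal.ofReal (Real.exp ⟪t • S z, g⟫) ∂(stdGaussian F) := by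
    intro z
    rw [lintegral_exp_inner, norm_smul, mul_pow, Real.norm_eq_abs, sq_abs, ht2]
    congr 2; ring
  simp_rw [h1]
  rw [lintegral_lintegral_swap]
  · rw [← lintegral_exp_sq_stdGaussian (F := F)]
    refine lintegral_mono fun g => ?_
    have h2 : ∀ z, ⟪t • S z, g⟫ = ⟪t • ContinuousLinearMap.adjoint S g, z⟫ := by
      intro z
      rw [real_inner_smul_left, real_inner_smul_left, ContinuousLinearMap.adjoint_inner_left,
        real_inner_comm]
    simp_rw [h2]
    rw [lintegral_exp_inner, norm_smul, mul_pow, Real.norm_eq_abs, sq_abs, ht2]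
    refine ENNReal.ofReal_le_ofReal (Real.exp_le_exp.2 ?_)
    have := pow_le_pow_left₀ (norm_nonneg _) (hadj g) 2
    linarith
  · refine Measurable.aemeasurable ?_
    have : Continuous (Function.uncurry fun (z : E) (g : F) => ⟪t • S z, g⟫) := by
      unfold Function.uncurry; fun_prop
    exact (Real.continuous_exp.comp this).measurable.ennreal_ofReal

/-- Exponential moment of a sum of squares of bounded linear maps with values in a space of
real dimension two, the squared bounds summing up to at most one. -/
lemma lintegral_exp_sum_sq {κ : Type*} [Fintype κ] (hF : Module.finrank ℝ F = 2)
    (S : κ → E →L[ℝ] F) (c : κ → ℝ) (hS : ∀ j z, ‖S j z‖ ≤ c j * ‖z‖) (hc0 : ∀ j, 0 ≤ c j)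
    (hc : ∑ j, c j ^ 2 ≤ 1) :
    ∫⁻ z, ENNReal.ofReal (Real.exp ((∑ j, ‖S j z‖ ^ 2) / 4)) ∂(stdGaussian E) ≤ 2 := by
  -- Jensen with weights c_j²; the extra point of `Option κ` carries the missing mass 1 - ∑ c_j² at
  -- exponent 0.
  have key : ∀ z, Real.exp ((∑ j, ‖S j z‖ ^ 2) / 4)
      ≤ (1 - ∑ j, c j ^ 2) + ∑ j, c j ^ 2 * Real.exp (‖((c j)⁻¹ • S j) z‖ ^ 2 / 4) := by
    intro z
    have hx : ∀ j, c j ^ 2 * (‖((c j)⁻¹ • S j) z‖ ^ 2 / 4) = ‖S j z‖ ^ 2 / 4 := by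
      intro j
      rcases eq_or_ne (c j) 0 with h | h
      · have := hS j z
        rw [h, zero_mul] at this
        have h0 : ‖S j z‖ = 0 := le_antisymm this (norm_nonneg _)
        rw [h, h0]; simp
      · rw [_root_.smul_apply, norm_smul, Real.norm_eq_abs, mul_pow, sq_abs]
        field_simp
    have hj := convexOn_exp.map_sum_le (t := Finset.univ)
      (w := fun o : Option κ => o.elim (1 - ∑ j, c j ^ 2) (fun j => c j ^ 2))
      (p := fun o : Option κ => o.elim 0 (fun j => ‖((c j)⁻¹ • S j) z‖ ^ 2 / 4))
      (by
        rintro (_ | j) _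
        · simpa using hc
        · simpa using sq_nonneg (c j)) (by simp [Fintype.sum_option]) (by simp)
    simp only [Fintype.sum_option, Option.elim, smul_eq_mul, mul_zero, zero_add, Real.exp_zero,
      mul_one] at hj
    simp_rw [hx] at hj
    rw [Finset.sum_div]
    exact hj
  have h1 : ∀ j, ∫⁻ z, ENNReal.ofReal (Real.exp (‖((c j)⁻¹ • S j) z‖ ^ 2 / 4)) ∂(stdGaussian E)
      ≤ 2 := by
    intro j
    refine (lintegral_exp_sq_contraction ((c j)⁻¹ • S j) fun z => ?_).trans ?_
    · rw [_root_.smul_apply, norm_smul, norm_inv, Real.norm_eq_abs,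
        abs_of_nonneg (hc0 j)]
      rcases eq_or_lt_of_le (hc0 j) with h | h
      · rw [← h]; simp
      · rw [inv_mul_le_iff₀ h]; exact hS j z
    · rw [hF, Real.sq_sqrt (by norm_num)]; simp
  calc ∫⁻ z, ENNReal.ofReal (Real.exp ((∑ j, ‖S j z‖ ^ 2) / 4)) ∂(stdGaussian E)
      ≤ ∫⁻ z, (ENNReal.ofReal (1 - ∑ j, c j ^ 2) + ∑ j, ENNReal.ofReal (c j ^ 2) *
          ENNReal.ofReal (Real.exp (‖((c j)⁻¹ • S j) z‖ ^ 2 / 4))) ∂(stdGaussian E) := by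
        refine lintegral_mono fun z => ?_
        refine (ENNReal.ofReal_le_ofReal (key z)).trans ?_
        refine ENNReal.ofReal_add_le.trans (add_le_add le_rfl ?_)
        rw [ENNReal.ofReal_sum_of_nonneg (fun j _ => by positivity)]
        exact Finset.sum_le_sum fun j _ => (ENNReal.ofReal_mul (sq_nonneg _)).le
    _ ≤ ENNReal.ofReal (1 - ∑ j, c j ^ 2) + ∑ j, ENNReal.ofReal (c j ^ 2) * 2 := by
        rw [lintegral_add_left measurable_const, lintegral_finsetSum _ (fun j _ => by fun_prop)]
        simp only [lintegral_const, measure_univ, mul_one]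
        refine add_le_add le_rfl (Finset.sum_le_sum fun j _ => ?_)
        rw [lintegral_const_mul _ (by fun_prop)]
        exact mul_le_mul_right (h1 j) _
    _ ≤ 2 := by
        rw [← Finset.sum_mul, ← ENNReal.ofReal_sum_of_nonneg (fun j _ => sq_nonneg _)]
        have : (2 : ENNReal) = ENNReal.ofReal 2 := by simp
        rw [this, ← ENNReal.ofReal_mul (Finset.sum_nonneg fun j _ => sq_nonneg _),
          ← ENNReal.ofReal_add (by linarith)
            (by have := Finset.sum_nonneg fun j (_ : j ∈ Finset.univ) => sq_nonneg (c j); linarith)]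
        exact ENNReal.ofReal_le_ofReal (by linarith)

/-- A pair of independent standard Gaussian vectors is invariant under rotation by `π / 4`. -/
lemma measurePreserving_rotation :
    MeasurePreserving (fun p : E × E => ((Real.sqrt 2)⁻¹ • (p.1 + p.2), (Real.sqrt 2)⁻¹ • (p.1 - p.2)))
      ((stdGaussian E).prod (stdGaussian E)) ((stdGaussian E).prod (stdGaussian E)) := by
  have hm : Measurable (fun p : E × E =>
    ((Real.sqrt 2)⁻¹ • (p.1 + p.2), (Real.sqrt 2)⁻¹ • (p.1 - p.2))) := by fun_prop
  refine ⟨hm, ?_⟩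
  have : IsProbabilityMeasure (((stdGaussian E).prod (stdGaussian E)).map (fun p : E × E =>
    ((Real.sqrt 2)⁻¹ • (p.1 + p.2), (Real.sqrt 2)⁻¹ • (p.1 - p.2)))) :=
    Measure.isProbabilityMeasure_map hm.aemeasurable
  refine charFun_eq_prod_iff.1 fun t => ?_
  have h1 : charFun (Measure.map (WithLp.toLp 2) (((stdGaussian E).prod (stdGaussian E)).map
      (fun p : E × E => ((Real.sqrt 2)⁻¹ • (p.1 + p.2), (Real.sqrt 2)⁻¹ • (p.1 - p.2))))) t
      = charFun (Measure.map (WithLp.toLp 2) ((stdGaussian E).prod (stdGaussian E)))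
        (WithLp.toLp 2 ((Real.sqrt 2)⁻¹ • (t.fst + t.snd), (Real.sqrt 2)⁻¹ • (t.fst - t.snd))) := by
    simp only [charFun_apply]
    simp_rw [← MeasurableEquiv.coe_toLp]
    rw [integral_map_equiv, integral_map_equiv, integral_map hm.aemeasurable (by fun_prop)]
    refine integral_congr_ae (Filter.Eventually.of_forall fun p => ?_)
    simp only [MeasurableEquiv.coe_toLp, WithLp.prod_inner_apply, real_inner_smul_left, real_inner_smul_right,
      inner_add_left, inner_sub_left, inner_add_right, inner_sub_right]
    congr 3
    simp only [WithLp.fst, WithLp.snd]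
    ring
  rw [h1, charFun_prod]
  simp only [charFun_stdGaussian]
  rw [← Complex.exp_add, ← Complex.exp_add]
  congr 1
  have hs : ((Real.sqrt 2)⁻¹ : ℝ) ^ 2 = 1 / 2 := by
    rw [inv_pow, Real.sq_sqrt (by norm_num)]; norm_num
  have hp := parallelogram_law_with_norm ℝ t.fst t.snd
  have hR : -(‖(Real.sqrt 2)⁻¹ • (t.fst + t.snd)‖ ^ 2) / 2 + -(‖(Real.sqrt 2)⁻¹ • (t.fst - t.snd)‖ ^ 2) / 2
      = -(‖t.fst‖ ^ 2) / 2 + -(‖t.snd‖ ^ 2) / 2 := by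
    rw [norm_smul, norm_smul, mul_pow, mul_pow, Real.norm_eq_abs, sq_abs, hs]
    linarith
  have := congrArg (fun r : ℝ => (r : ℂ)) hR
  push_cast at this ⊢
  exact this

end StdGaussian

/-! ### Second moments and exponential moments of quadratic forms. -/

section StdGaussianMoments

open scoped RealInnerProductSpace

variable {E : Type*} [NormedAddCommGroup E] [InnerProductSpace ℝ E] [FiniteDimensional ℝ E]
  [MeasurableSpace E] [BorelSpace E]
variable {F : Type*} [NormedAddCommGroup F] [InnerProductSpace ℝ F] [FiniteDimensional ℝ F]

lemma memLp_norm_stdGaussian : MemLp (fun z : E => ‖z‖) 2 (stdGaussian E) :=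
  (IsGaussian.memLp_two_id (μ := stdGaussian E)).norm

lemma integrable_norm_sq_stdGaussian : Integrable (fun z : E => ‖z‖ ^ 2) (stdGaussian E) :=
  memLp_norm_stdGaussian.integrable_sq

lemma integrable_inner_stdGaussian (v : E) : Integrable (fun z => ⟪v, z⟫) (stdGaussian E) :=
  IsGaussian.integrable_dual _ (innerSL ℝ v)

lemma integrable_inner_map_stdGaussian (S V : E →L[ℝ] F) :
    Integrable (fun z => ⟪S z, V z⟫) (stdGaussian E) := by
  refine (integrable_norm_sq_stdGaussian.const_mul (‖S‖ * ‖V‖)).mono' (by fun_prop)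
    (Filter.Eventually.of_forall fun z => ?_)
  refine (norm_inner_le_norm _ _).trans ?_
  calc ‖S z‖ * ‖V z‖ ≤ (‖S‖ * ‖z‖) * (‖V‖ * ‖z‖) := by
        gcongr
        · exact S.le_opNorm z
        · exact V.le_opNorm z
    _ = ‖S‖ * ‖V‖ * ‖z‖ ^ 2 := by ring

lemma integrable_inner_mul_inner_stdGaussian (v w : E) :
    Integrable (fun z => ⟪v, z⟫ * ⟪w, z⟫) (stdGaussian E) := by
  refine (integrable_norm_sq_stdGaussian.const_mul (‖v‖ * ‖w‖)).mono' (by fun_prop)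
    (Filter.Eventually.of_forall fun z => ?_)
  rw [norm_mul]
  calc ‖⟪v, z⟫‖ * ‖⟪w, z⟫‖ ≤ (‖v‖ * ‖z‖) * (‖w‖ * ‖z‖) := by
        gcongr <;> exact norm_inner_le_norm _ _
    _ = ‖v‖ * ‖w‖ * ‖z‖ ^ 2 := by ring

lemma integral_inner_stdGaussian (v : E) : ∫ z, ⟪v, z⟫ ∂(stdGaussian E) = 0 :=
  integral_strongDual_stdGaussian (innerSL ℝ v)

lemma integral_inner_mul_inner_stdGaussian (v w : E) :
    ∫ z, ⟪v, z⟫ * ⟪w, z⟫ ∂(stdGaussian E) = ⟪v, w⟫ := by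
  have h := covarianceBilin_apply (IsGaussian.memLp_two_id (μ := stdGaussian E)) v w
  have h0 : ∫ z, id z ∂(stdGaussian E) = 0 := integral_id_stdGaussian
  rw [h0, covarianceBilin_stdGaussian] at h
  simp only [sub_zero] at h
  exact h.symm

lemma integral_add_inner_sq_stdGaussian (β : ℝ) (v : E) :
    ∫ z, (β + ⟪v, z⟫) ^ 2 ∂(stdGaussian E) = β ^ 2 + ‖v‖ ^ 2 := by
  have h : ∀ z, (β + ⟪v, z⟫) ^ 2 = (β ^ 2 + (2 * β) * ⟪v, z⟫) + ⟪v, z⟫ * ⟪v, z⟫ := fun z => by ring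
  simp_rw [h]
  have i1 : Integrable (fun z => (2 * β) * ⟪v, z⟫) (stdGaussian E) :=
    (integrable_inner_stdGaussian v).const_mul _
  have i2 : Integrable (fun z => β ^ 2 + (2 * β) * ⟪v, z⟫) (stdGaussian E) :=
    (integrable_const _).add i1
  rw [integral_add i2 (integrable_inner_mul_inner_stdGaussian v v),
    integral_add (integrable_const _) i1, integral_const_mul, integral_inner_stdGaussian,
    integral_inner_mul_inner_stdGaussian, real_inner_self_eq_norm_sq]
  simp

lemma ofReal_integral_le_lintegral {Ω : Type*} [MeasurableSpace Ω] {μ : Measure Ω} {f : Ω → ℝ}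
    (hf : Integrable f μ) : ENNReal.ofReal (∫ x, f x ∂μ) ≤ ∫⁻ x, ENNReal.ofReal (f x) ∂μ := by
  rw [integral_eq_lintegral_pos_part_sub_lintegral_neg_part hf]
  refine (ENNReal.ofReal_le_ofReal (sub_le_self _ ENNReal.toReal_nonneg)).trans ?_
  exact ENNReal.ofReal_toReal_le

/-- Exponential moment of a centered quadratic form of a standard Gaussian vector. -/
lemma lintegral_exp_quadratic (S V : E →L[ℝ] F) (l M : ℝ) (hS : ∀ z, ‖S z‖ ≤ ‖z‖)
    (hV : ∫⁻ b, ENNReal.ofReal (Real.exp (2 * l ^ 2 * ‖V b‖ ^ 2)) ∂(stdGaussian E) ≤ 2)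
    (hM : l * ∫ z, ⟪S z, V z⟫ ∂(stdGaussian E) ≤ M) :
    ∫⁻ z, ENNReal.ofReal (Real.exp (l * ⟪S z, V z⟫)) ∂(stdGaussian E)
      ≤ ENNReal.ofReal (2 * Real.exp M) := by
  set q : E → ℝ := fun z => ⟪S z, V z⟫ with hq
  have hqc : Continuous q := by fun_prop
  set ν := stdGaussian E with hν
  have hadj : ∀ g, ‖ContinuousLinearMap.adjoint S g‖ ≤ ‖g‖ := by
    intro g
    refine ((ContinuousLinearMap.adjoint S).le_opNorm g).trans ?_
    rw [LinearIsometryEquiv.norm_map]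
    have : ‖S‖ ≤ 1 := ContinuousLinearMap.opNorm_le_bound _ zero_le_one (by simpa using hS)
    nlinarith [norm_nonneg g]
  -- decoupled form
  have hdec : ∫⁻ b, ∫⁻ a, ENNReal.ofReal (Real.exp (2 * l * ⟪S a, V b⟫)) ∂ν ∂ν ≤ 2 := by
    refine le_trans (lintegral_mono fun b => ?_) hV
    have h2 : ∀ a, 2 * l * ⟪S a, V b⟫ = ⟪(2 * l) • ContinuousLinearMap.adjoint S (V b), a⟫ := by
      intro a
      rw [real_inner_smul_left, ContinuousLinearMap.adjoint_inner_left, real_inner_comm]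
    simp_rw [h2]
    rw [lintegral_exp_inner, norm_smul, mul_pow, Real.norm_eq_abs, sq_abs]
    refine ENNReal.ofReal_le_ofReal (Real.exp_le_exp.2 ?_)
    have := pow_le_pow_left₀ (norm_nonneg _) (hadj (V b)) 2
    nlinarith [sq_nonneg l]
  have hm1 : Measurable fun p : E × E => ENNReal.ofReal (Real.exp (2 * l * ⟪S p.1, V p.2⟫)) := by
    have : Continuous fun p : E × E => 2 * l * ⟪S p.1, V p.2⟫ := by fun_prop
    exact (Real.continuous_exp.comp this).measurable.ennreal_ofReal
  have hm2 : Measurable fun p : E × E => ENNReal.ofReal (Real.exp (2 * l * ⟪S p.2, V p.1⟫)) := by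
    have : Continuous fun p : E × E => 2 * l * ⟪S p.2, V p.1⟫ := by fun_prop
    exact (Real.continuous_exp.comp this).measurable.ennreal_ofReal
  have hmq : Measurable fun z => ENNReal.ofReal (Real.exp (l * q z)) := by
    have : Continuous fun z => l * q z := by fun_prop
    exact (Real.continuous_exp.comp this).measurable.ennreal_ofReal
  have hmq' : Measurable fun z => ENNReal.ofReal (Real.exp (-(l * q z))) := by
    have : Continuous fun z => -(l * q z) := by fun_prop
    exact (Real.continuous_exp.comp this).measurable.ennreal_ofReal
  -- The product is an expectation of exp(l(q(u) - q(v))) over independent u, v. Substituting u =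
  -- (a+b)/√2, v = (a-b)/√2 cancels the diagonal terms and leaves l(⟨Sa,Vb⟩ + ⟨Sb,Va⟩). Convexity
  -- separates the two summands at the cost of doubling l, and each is linear in one variable given
  -- the other.
  have hprod : (∫⁻ z, ENNReal.ofReal (Real.exp (l * q z)) ∂ν) *
      (∫⁻ z, ENNReal.ofReal (Real.exp (-(l * q z))) ∂ν) ≤ 2 := by
    rw [← lintegral_prod_mul hmq.aemeasurable hmq'.aemeasurable,
      ← (measurePreserving_rotation (E := E)).lintegral_comp
        (f := fun p : E × E => ENNReal.ofReal (Real.exp (l * q p.1)) *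
          ENNReal.ofReal (Real.exp (-(l * q p.2))))
        ((hmq.comp measurable_fst).mul (hmq'.comp measurable_snd))]
    calc _ ≤ ∫⁻ p, (2⁻¹ * ENNReal.ofReal (Real.exp (2 * l * ⟪S p.1, V p.2⟫)) +
          2⁻¹ * ENNReal.ofReal (Real.exp (2 * l * ⟪S p.2, V p.1⟫))) ∂(ν.prod ν) := by
          refine lintegral_mono fun p => ?_
          obtain ⟨a, b⟩ := p
          have hs : (Real.sqrt 2)⁻¹ * (Real.sqrt 2)⁻¹ = (1 / 2 : ℝ) := by
            rw [← mul_inv, Real.mul_self_sqrt (by norm_num)]; norm_num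
          have he : l * q ((Real.sqrt 2)⁻¹ • (a + b)) + -(l * q ((Real.sqrt 2)⁻¹ • (a - b)))
              = (1 / 2) * (2 * l * ⟪S a, V b⟫) + (1 / 2) * (2 * l * ⟪S b, V a⟫) := by
            simp only [hq, map_smul, map_add, map_sub, real_inner_smul_left,
              real_inner_smul_right, inner_add_left, inner_sub_left, inner_add_right,
              inner_sub_right]
            linear_combination (2 * l * (⟪S a, V b⟫ + ⟪S b, V a⟫)) * hs
          have hc := convexOn_exp.2 (Set.mem_univ (2 * l * ⟪S a, V b⟫))
            (Set.mem_univ (2 * l * ⟪S b, V a⟫)) (by norm_num : (0 : ℝ) ≤ 1 / 2)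
            (by norm_num : (0 : ℝ) ≤ 1 / 2) (by norm_num)
          simp only [smul_eq_mul] at hc
          have h2 : (2⁻¹ : ENNReal) = ENNReal.ofReal (1 / 2) := by
            rw [one_div, ENNReal.ofReal_inv_of_pos (by norm_num)]; simp
          rw [← ENNReal.ofReal_mul (Real.exp_pos _).le, ← Real.exp_add, he, h2,
            ← ENNReal.ofReal_mul (by norm_num), ← ENNReal.ofReal_mul (by norm_num),
            ← ENNReal.ofReal_add (by positivity) (by positivity)]
          exact ENNReal.ofReal_le_ofReal hc
      _ ≤ 2⁻¹ * 2 + 2⁻¹ * 2 := by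
          rw [lintegral_add_left (hm1.const_mul _), lintegral_const_mul _ hm1,
            lintegral_const_mul _ hm2]
          refine add_le_add (mul_le_mul_right ?_ _) (mul_le_mul_right ?_ _)
          · rw [lintegral_prod_symm' _ hm1]; exact hdec
          · rw [lintegral_prod _ hm2.aemeasurable]; exact hdec
      _ = 2 := by
          rw [ENNReal.inv_mul_cancel (by norm_num) (by norm_num)]; norm_num
  -- Jensen bounds the second factor of the product from below, so the bound on the product becomes
  -- one on the first factor. The tangent line of exp at -l·m is used directly, which needs only
  -- integrability of q.
  have hJ : ENNReal.ofReal (Real.exp (-M)) ≤ ∫⁻ z, ENNReal.ofReal (Real.exp (-(l * q z))) ∂ν := by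
    have hqi : Integrable q ν := integrable_inner_map_stdGaussian S V
    set m := ∫ z, q z ∂ν with hm
    have hint : Integrable (fun z => Real.exp (-(l * m)) * ((1 + l * m) - l * q z)) ν :=
      ((integrable_const _).sub (hqi.const_mul l)).const_mul _
    have hval : ∫ z, Real.exp (-(l * m)) * ((1 + l * m) - l * q z) ∂ν = Real.exp (-(l * m)) := by
      rw [integral_const_mul, integral_sub (integrable_const _) (hqi.const_mul l),
        integral_const_mul, ← hm]
      simp
    calc ENNReal.ofReal (Real.exp (-M)) ≤ ENNReal.ofReal (Real.exp (-(l * m))) :=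
          ENNReal.ofReal_le_ofReal (Real.exp_le_exp.2 (by linarith))
      _ ≤ _ := by
          rw [← hval]
          refine (ofReal_integral_le_lintegral hint).trans (lintegral_mono fun z => ?_)
          refine ENNReal.ofReal_le_ofReal ?_
          have h := Real.add_one_le_exp (l * m - l * q z)
          calc _ ≤ Real.exp (-(l * m)) * Real.exp (l * m - l * q z) := by
                gcongr; linarith
            _ = _ := by rw [← Real.exp_add]; congr 1; ring
  have hfin : (∫⁻ z, ENNReal.ofReal (Real.exp (l * q z)) ∂ν) * ENNReal.ofReal (Real.exp (-M)) ≤ 2 :=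
    (mul_le_mul_right hJ _).trans hprod
  calc ∫⁻ z, ENNReal.ofReal (Real.exp (l * q z)) ∂ν
      = (∫⁻ z, ENNReal.ofReal (Real.exp (l * q z)) ∂ν) * ENNReal.ofReal (Real.exp (-M))
          * ENNReal.ofReal (Real.exp M) := by
        rw [mul_assoc, ← ENNReal.ofReal_mul (Real.exp_pos _).le, ← Real.exp_add]; simp
    _ ≤ 2 * ENNReal.ofReal (Real.exp M) := mul_le_mul_left hfin _
    _ = _ := by rw [ENNReal.ofReal_mul (by norm_num)]; simp

end StdGaussianMoments

/-! ### Complex Gaussian coordinates as a standard Gaussian on a real Hilbert space. -/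

section ComplexCoordinates

variable {ι : Type*} [Fintype ι]

lemma real_inner_eq_re (v z : EuclideanSpace ℂ ι) :
    inner ℝ v z = (∑ i, z i * (starRingEnd ℂ) (v i)).re := by
  rw [PiLp.inner_apply, Complex.re_sum]
  exact Finset.sum_congr rfl fun i _ => Complex.inner _ _

instance : IsProbabilityMeasure stdComplexGaussian :=
  Measure.isProbabilityMeasure_map (by
    have : Measurable fun p : ℝ × ℝ => (⟨p.1, p.2⟩ : ℂ) := Complex.measurableEquivRealProd.symm.measurable
    exact this.aemeasurable)

lemma charFun_stdComplexGaussian (t : ℂ) :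
    charFun stdComplexGaussian t = Complex.exp (-‖t‖ ^ 2 / 2) := by
  have hm : Measurable fun p : ℝ × ℝ => (⟨p.1, p.2⟩ : ℂ) :=
    Complex.measurableEquivRealProd.symm.measurable
  have h1 : charFun stdComplexGaussian t
      = charFun (gaussianReal 0 1) t.re * charFun (gaussianReal 0 1) t.im := by
    rw [charFun_apply, stdComplexGaussian, integral_map hm.aemeasurable (by fun_prop),
      charFun_apply, charFun_apply, ← integral_prod_mul]
    refine integral_congr_ae (Filter.Eventually.of_forall fun p => ?_)
    simp only [← Complex.exp_add]
    congr 1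
    rw [Complex.inner]
    simp
    ring
  rw [h1, charFun_gaussianReal, charFun_gaussianReal, ← Complex.exp_add]
  congr 1
  have : (‖t‖ ^ 2 : ℝ) = t.re ^ 2 + t.im ^ 2 := by
    rw [← Complex.normSq_eq_norm_sq, Complex.normSq_apply]; ring
  have h2 := congrArg (fun r : ℝ => (r : ℂ)) this
  push_cast at h2 ⊢
  rw [h2]
  ring

/-- Both sides have characteristic function exp(-‖t‖²/2). The convention E|ζ|² = 2 is what makes the
real structure on complex Euclidean space fit without rescaling. -/
lemma map_pi_stdComplexGaussian :
    (Measure.pi fun _ : ι => stdComplexGaussian).map (WithLp.toLp 2)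
      = stdGaussian (EuclideanSpace ℂ ι) := by
  apply Measure.ext_of_charFun (E := EuclideanSpace ℂ ι)
  ext t
  rw [charFun_stdGaussian, charFun_pi]
  simp_rw [charFun_stdComplexGaussian]
  rw [← Complex.exp_sum, ← Finset.sum_div, Finset.sum_neg_distrib]
  have := congrArg (fun r : ℝ => (r : ℂ)) (EuclideanSpace.norm_sq_eq t)
  push_cast at this
  rw [this]

/-- The vector of coefficients as the representing vector of the real part of a linear form. -/
def conjVec (a : ℂ) (c : ι → ℂ) : EuclideanSpace ℂ ι :=
  WithLp.toLp 2 fun i => (starRingEnd ℂ) (a * c i)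

lemma inner_conjVec (a : ℂ) (c : ι → ℂ) (z : EuclideanSpace ℂ ι) :
    inner ℝ (conjVec a c) z = (a * ∑ i, c i * z i).re := by
  rw [real_inner_eq_re, Finset.mul_sum]
  congr 1
  refine Finset.sum_congr rfl fun i _ => ?_
  simp [conjVec]
  ring

lemma norm_sq_conjVec (a : ℂ) (c : ι → ℂ) :
    ‖conjVec a c‖ ^ 2 = ‖a‖ ^ 2 * ∑ i, ‖c i‖ ^ 2 := by
  rw [EuclideanSpace.norm_sq_eq, Finset.mul_sum]
  refine Finset.sum_congr rfl fun i _ => ?_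
  simp [conjVec, mul_pow]

lemma integral_norm_sq_affine (b : ℂ) (c : ι → ℂ) :
    ∫ z, ‖b + ∑ i, c i * z i‖ ^ 2 ∂(stdGaussian (EuclideanSpace ℂ ι))
      = ‖b‖ ^ 2 + 2 * ∑ i, ‖c i‖ ^ 2 := by
  have h : ∀ z : EuclideanSpace ℂ ι, ‖b + ∑ i, c i * z i‖ ^ 2
      = (b.re + inner ℝ (conjVec 1 c) z) ^ 2 + (b.im + inner ℝ (conjVec (-Complex.I) c) z) ^ 2 := by
    intro z
    rw [inner_conjVec, inner_conjVec, ← Complex.normSq_eq_norm_sq, Complex.normSq_apply]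
    simp
    ring
  have hi : ∀ (β : ℝ) (v : EuclideanSpace ℂ ι),
      Integrable (fun z => (β + inner ℝ v z) ^ 2) (stdGaussian (EuclideanSpace ℂ ι)) := by
    intro β v
    have h : ∀ z, (β + inner ℝ v z) ^ 2 = (β ^ 2 + (2 * β) * inner ℝ v z)
        + inner ℝ v z * inner ℝ v z := fun z => by ring
    simp_rw [h]
    exact ((integrable_const _).add ((integrable_inner_stdGaussian v).const_mul _)).add
      (integrable_inner_mul_inner_stdGaussian v v)
  simp_rw [h]
  rw [integral_add (hi _ _) (hi _ _), integral_add_inner_sq_stdGaussian,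
    integral_add_inner_sq_stdGaussian, norm_sq_conjVec, norm_sq_conjVec,
    ← Complex.normSq_eq_norm_sq b, Complex.normSq_apply]
  simp
  ring

lemma integrable_re_conj_mul [DecidableEq ι] (i : ι) (c : ι → ℂ) :
    Integrable (fun z : EuclideanSpace ℂ ι => ((∑ j, c j * z j) * (starRingEnd ℂ) (z i)).re)
      (stdGaussian (EuclideanSpace ℂ ι)) ∧
    ∫ z : EuclideanSpace ℂ ι, ((∑ j, c j * z j) * (starRingEnd ℂ) (z i)).re
      ∂(stdGaussian (EuclideanSpace ℂ ι)) = 2 * (c i).re := by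
  have h : ∀ z : EuclideanSpace ℂ ι, ((∑ j, c j * z j) * (starRingEnd ℂ) (z i)).re
      = inner ℝ (conjVec 1 (Pi.single i 1)) z * inner ℝ (conjVec 1 c) z
        + inner ℝ (conjVec (-Complex.I) (Pi.single i 1)) z * inner ℝ (conjVec (-Complex.I) c) z := by
    intro z
    simp only [inner_conjVec, Pi.single_apply, ite_mul, one_mul, zero_mul, Finset.sum_ite_eq',
      Finset.mem_univ, if_true]
    simp
    ring
  simp_rw [h]
  refine ⟨(integrable_inner_mul_inner_stdGaussian _ _).add
    (integrable_inner_mul_inner_stdGaussian _ _), ?_⟩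
  rw [integral_add (integrable_inner_mul_inner_stdGaussian _ _)
    (integrable_inner_mul_inner_stdGaussian _ _), integral_inner_mul_inner_stdGaussian,
    integral_inner_mul_inner_stdGaussian, real_inner_comm, inner_conjVec, real_inner_eq_re]
  simp [conjVec, Pi.single_apply]
  ring

end ComplexCoordinates

/-! ### The unitary Fourier basis and the spectral ℓ₁ norm. -/

section Fourier

variable {n : ℕ}

/-- The characters `exp (2πi k t / (n + 1))`. -/
def chi (n k t : ℕ) : ℂ :=
  Complex.exp (2 * Real.pi * Complex.I * (k : ℂ) * (t : ℂ) / ((n : ℂ) + 1))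

/-- The filters of the unitary Fourier basis of `ℂ^{n+1}`. -/
def atom (n : ℕ) (k : Fin (n + 1)) : Fin (n + 1) → ℂ :=
  fun j => ((1 / Real.sqrt ((n : ℝ) + 1) : ℝ) : ℂ) * (starRingEnd ℂ) (chi n k j)

lemma chi_eq_pow (n k t : ℕ) :
    chi n k t = (Complex.exp (2 * Real.pi * Complex.I / ((n + 1 : ℕ) : ℂ)) ^ t) ^ k := by
  rw [chi, ← pow_mul, ← Complex.exp_nat_mul]
  congr 1
  push_cast
  ring

lemma chi_add (n k s t : ℕ) : chi n k (s + t) = chi n k s * chi n k t := by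
  rw [chi_eq_pow, chi_eq_pow, chi_eq_pow, pow_add, mul_pow]

lemma norm_chi (n k t : ℕ) : ‖chi n k t‖ = 1 := by
  have h := (Complex.isPrimitiveRoot_exp (n + 1) n.succ_ne_zero).norm'_eq_one n.succ_ne_zero
  rw [chi_eq_pow, norm_pow, norm_pow, h, one_pow, one_pow]

lemma sum_chi_mul_conj (j t : Fin (n + 1)) :
    ∑ k : Fin (n + 1), chi n k t * (starRingEnd ℂ) (chi n k j)
      = if t = j then ((n : ℂ) + 1) else 0 := by
  set w := Complex.exp (2 * Real.pi * Complex.I / ((n + 1 : ℕ) : ℂ)) with hw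
  have hp : IsPrimitiveRoot w (n + 1) := Complex.isPrimitiveRoot_exp (n + 1) n.succ_ne_zero
  have hw0 : w ≠ 0 := Complex.exp_ne_zero _
  have hc : ∀ k : Fin (n + 1), chi n k t * (starRingEnd ℂ) (chi n k j)
      = (w ^ (t : ℕ) * (w ^ (j : ℕ))⁻¹) ^ (k : ℕ) := by
    intro k
    rw [← Complex.inv_eq_conj (norm_chi n k j), chi_eq_pow, chi_eq_pow, mul_pow, inv_pow]
  simp_rw [hc]
  rw [Fin.sum_univ_eq_sum_range (fun k => (w ^ (t : ℕ) * (w ^ (j : ℕ))⁻¹) ^ k)]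
  split_ifs with h
  · subst h
    rw [mul_inv_cancel₀ (pow_ne_zero _ hw0)]
    simp
  · set r := w ^ (t : ℕ) * (w ^ (j : ℕ))⁻¹ with hr
    have hr1 : r ≠ 1 := by
      intro h1
      rw [hr, mul_inv_eq_one₀ (pow_ne_zero _ hw0)] at h1
      exact h (Fin.ext (hp.pow_inj t.2 j.2 h1))
    have hrn : r ^ (n + 1) = 1 := by
      rw [hr, mul_pow, inv_pow, ← pow_mul, ← pow_mul, mul_comm, mul_comm (j : ℕ), mul_comm (t : ℕ),
        pow_mul, pow_mul, hp.pow_eq_one]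
      simp
    rw [geom_sum_eq hr1, hrn]
    simp

lemma dft_eq (φ : Fin (n + 1) → ℂ) (k : Fin (n + 1)) :
    dft φ k = ((1 / Real.sqrt ((n : ℝ) + 1) : ℝ) : ℂ) * ∑ t, φ t * chi n k t := rfl

lemma one_div_sqrt_mul_self (n : ℕ) :
    ((1 / Real.sqrt ((n : ℝ) + 1) : ℝ) : ℂ) * ((1 / Real.sqrt ((n : ℝ) + 1) : ℝ) : ℂ)
      = ((n : ℂ) + 1)⁻¹ := by
  rw [← Complex.ofReal_mul, div_mul_div_comm, one_mul, Real.mul_self_sqrt (by positivity)]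
  push_cast
  simp

/-- Fourier inversion. It writes a filter as a combination of n+1 fixed atoms with total weight
`specNorm1 φ`, which is how bounds uniform over all feasible filters become finite union bounds. -/
lemma eq_sum_dft_mul_atom (φ : Fin (n + 1) → ℂ) (j : Fin (n + 1)) :
    φ j = ∑ k, dft φ k * atom n k j := by
  have h : ∀ k, dft φ k * atom n k j
      = ((n : ℂ) + 1)⁻¹ * ∑ t, φ t * (chi n k t * (starRingEnd ℂ) (chi n k j)) := by
    intro k
    rw [dft_eq, atom, mul_mul_mul_comm, one_div_sqrt_mul_self, Finset.sum_mul]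
    simp_rw [mul_assoc]
  simp_rw [h]
  rw [← Finset.mul_sum, Finset.sum_comm]
  simp_rw [← Finset.mul_sum, sum_chi_mul_conj]
  have : (n : ℂ) + 1 ≠ 0 := Nat.cast_add_one_ne_zero n
  simp only [mul_ite, mul_zero, Finset.sum_ite_eq', Finset.mem_univ, if_true]
  field_simp

lemma norm_atom (k j : Fin (n + 1)) : ‖atom n k j‖ = 1 / Real.sqrt ((n : ℝ) + 1) := by
  rw [atom, norm_mul, RCLike.norm_conj, norm_chi, mul_one, Complex.norm_real, Real.norm_eq_abs,
    abs_of_nonneg (by positivity)]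

lemma sum_norm_atom_sq (k : Fin (n + 1)) : ∑ j, ‖atom n k j‖ ^ 2 = 1 := by
  simp_rw [norm_atom, div_pow, Real.sq_sqrt (by positivity : (0 : ℝ) ≤ (n : ℝ) + 1)]
  rw [Finset.sum_const, Finset.card_univ, Fintype.card_fin, nsmul_eq_mul]
  push_cast
  field_simp

lemma parseval (φ : Fin (n + 1) → ℂ) : ∑ k, ‖dft φ k‖ ^ 2 = ∑ j, ‖φ j‖ ^ 2 := by
  have h : (∑ k, (‖dft φ k‖ ^ 2 : ℂ)) = ∑ j, (‖φ j‖ ^ 2 : ℂ) := by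
    simp_rw [← Complex.mul_conj']
    have hc : ∀ k, (starRingEnd ℂ) (dft φ k) = ∑ j, (starRingEnd ℂ) (φ j) * atom n k j := by
      intro k
      rw [dft_eq, map_mul, map_sum, Complex.conj_ofReal, Finset.mul_sum]
      refine Finset.sum_congr rfl fun j _ => ?_
      rw [map_mul, atom]; ring
    simp_rw [hc, Finset.mul_sum]
    rw [Finset.sum_comm]
    refine Finset.sum_congr rfl fun j _ => ?_
    conv_rhs => rw [eq_sum_dft_mul_atom φ j, Finset.sum_mul]
    rw [← eq_sum_dft_mul_atom φ j]
    refine Finset.sum_congr rfl fun k _ => ?_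
    ring
  exact_mod_cast h

lemma specNorm1_nonneg (φ : Fin (n + 1) → ℂ) : 0 ≤ specNorm1 φ :=
  Finset.sum_nonneg fun _ _ => norm_nonneg _

lemma norm_apply_le_specNorm1 (φ : Fin (n + 1) → ℂ) (j : Fin (n + 1)) :
    ‖φ j‖ ≤ specNorm1 φ / Real.sqrt ((n : ℝ) + 1) := by
  rw [eq_sum_dft_mul_atom φ j, specNorm1, Finset.sum_div]
  refine (norm_sum_le _ _).trans (Finset.sum_le_sum fun k _ => ?_)
  rw [norm_mul, norm_atom, mul_one_div]

lemma sum_norm_le_specNorm1 (φ : Fin (n + 1) → ℂ) :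
    ∑ j, ‖φ j‖ ≤ specNorm1 φ * Real.sqrt ((n : ℝ) + 1) := by
  refine (Finset.sum_le_sum fun j _ => norm_apply_le_specNorm1 φ j).trans ?_
  rw [Finset.sum_const, Finset.card_univ, Fintype.card_fin, nsmul_eq_mul]
  have h := Real.mul_self_sqrt (by positivity : (0 : ℝ) ≤ (n : ℝ) + 1)
  have h0 : 0 < Real.sqrt ((n : ℝ) + 1) := Real.sqrt_pos.2 (by positivity)
  push_cast
  rw [mul_div_assoc', div_le_iff₀ h0, mul_assoc, h, mul_comm]

lemma sum_norm_sq_le_specNorm1 (φ : Fin (n + 1) → ℂ) :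
    ∑ j, ‖φ j‖ ^ 2 ≤ specNorm1 φ ^ 2 := by
  rw [← parseval]
  exact Finset.sum_sq_le_sq_sum_of_nonneg fun _ _ => norm_nonneg _

end Fourier

/-! ### Convolution algebra, shift-invariant subspaces, and the self-convolved filter. -/

section Convolution

variable {n : ℕ}

lemma conv_eq_sum_atom (φ : Fin (n + 1) → ℂ) (u : ℤ → ℂ) :
    conv φ u = ∑ k, dft φ k • conv (atom n k) u := by
  ext t
  simp only [conv, Finset.sum_apply, Pi.smul_apply, smul_eq_mul, Finset.mul_sum]
  rw [Finset.sum_comm]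
  refine Finset.sum_congr rfl fun j _ => ?_
  conv_lhs => rw [eq_sum_dft_mul_atom φ j, Finset.sum_mul]
  exact Finset.sum_congr rfl fun k _ => by ring

lemma conv_add {k : ℕ} (φ : Fin (k + 1) → ℂ) (u v : ℤ → ℂ) :
    conv φ (u + v) = conv φ u + conv φ v := by
  ext t
  simp only [conv, Pi.add_apply, mul_add, Finset.sum_add_distrib]

lemma conv_sub {k : ℕ} (φ : Fin (k + 1) → ℂ) (u v : ℤ → ℂ) :
    conv φ (u - v) = conv φ u - conv φ v := by
  ext t
  simp only [conv, Pi.sub_apply, mul_sub, Finset.sum_sub_distrib]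

lemma conv_smul {k : ℕ} (φ : Fin (k + 1) → ℂ) (c : ℂ) (u : ℤ → ℂ) :
    conv φ (c • u) = c • conv φ u := by
  ext t
  simp only [conv, Pi.smul_apply, smul_eq_mul, Finset.mul_sum]
  exact Finset.sum_congr rfl fun k _ => by ring

lemma conv_comm {k l : ℕ} (φ : Fin (k + 1) → ℂ) (ψ : Fin (l + 1) → ℂ) (u : ℤ → ℂ) :
    conv φ (conv ψ u) = conv ψ (conv φ u) := by
  ext t
  simp only [conv, Finset.mul_sum]
  rw [Finset.sum_comm]
  refine Finset.sum_congr rfl fun i _ => Finset.sum_congr rfl fun j _ => ?_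
  rw [sub_right_comm]
  ring

lemma shift_pow_apply (j : ℕ) (u : ℤ → ℂ) (t : ℤ) : (shift ^ j) u t = u (t - j) := by
  induction j generalizing t with
  | zero => simp
  | succ j ih =>
    rw [pow_succ', Module.End.mul_apply]
    change (shift ^ j) u (t - 1) = _
    rw [ih]
    congr 1
    push_cast
    ring

lemma conv_eq_sum_shift {k : ℕ} (φ : Fin (k + 1) → ℂ) (u : ℤ → ℂ) :
    conv φ u = ∑ j : Fin (k + 1), φ j • (shift ^ (j : ℕ)) u := by
  ext t
  simp only [conv, Finset.sum_apply, Pi.smul_apply, smul_eq_mul, shift_pow_apply]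

lemma shift_pow_mem {S : Submodule ℂ (ℤ → ℂ)} (hS : S.map shift = S) {u : ℤ → ℂ} (hu : u ∈ S)
    (j : ℕ) : (shift ^ j) u ∈ S := by
  induction j with
  | zero => simpa using hu
  | succ j ih =>
    rw [pow_succ', Module.End.mul_apply]
    have := Submodule.mem_map_of_mem (f := shift) ih
    rwa [hS] at this

/-- A one-sided filter is a polynomial in the shift. The conclusion holds for every filter at once,
hence also for one chosen from the data. -/
lemma conv_mem {S : Submodule ℂ (ℤ → ℂ)} (hS : S.map shift = S) {u : ℤ → ℂ} (hu : u ∈ S)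
    {k : ℕ} (φ : Fin (k + 1) → ℂ) : conv φ u ∈ S := by
  rw [conv_eq_sum_shift]
  exact S.sum_mem fun j _ => S.smul_mem _ (shift_pow_mem hS hu j)

/-- The self-convolution of a filter supported on `[0, m]`. -/
def convSq {m : ℕ} (φ : Fin (m + 1) → ℂ) : Fin (2 * m + 1) → ℂ :=
  fun j => ∑ a : Fin (m + 1), ∑ b : Fin (m + 1), if (a : ℕ) + b = j then φ a * φ b else 0

/-- Stated for a general test function f so that f(j) = u(t - j) yields iterated convolution and f a
character yields the convolution theorem. Sums a + b never leave [0, 2m], so nothing is truncated.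
-/
lemma sum_convSq_mul {m : ℕ} (φ : Fin (m + 1) → ℂ) (f : ℕ → ℂ) :
    ∑ j, convSq φ j * f j = ∑ a, ∑ b, φ a * φ b * f (a + b) := by
  simp only [convSq, Finset.sum_mul]
  rw [Finset.sum_comm]
  refine Finset.sum_congr rfl fun a _ => ?_
  rw [Finset.sum_comm]
  refine Finset.sum_congr rfl fun b _ => ?_
  have hlt : (a : ℕ) + b < 2 * m + 1 := by omega
  rw [Finset.sum_eq_single (⟨a + b, hlt⟩ : Fin (2 * m + 1))]
  · simp
  · intro j _ hj
    rw [if_neg, zero_mul]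
    intro h
    exact hj (Fin.ext h.symm)
  · simp

lemma conv_convSq {m : ℕ} (φ : Fin (m + 1) → ℂ) (u : ℤ → ℂ) :
    conv (convSq φ) u = conv φ (conv φ u) := by
  ext t
  have h := sum_convSq_mul φ (fun j => u (t - j))
  rw [conv, h]
  simp only [conv, Finset.mul_sum]
  refine Finset.sum_congr rfl fun a _ => Finset.sum_congr rfl fun b _ => ?_
  push_cast
  rw [mul_assoc, sub_sub]

/-- Extension of a filter supported on `[0, m]` by zero to `[0, 2m]`. -/
def padZero {m : ℕ} (φ : Fin (m + 1) → ℂ) : Fin (2 * m + 1) → ℂ :=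
  fun j => if h : (j : ℕ) < m + 1 then φ ⟨j, h⟩ else 0

lemma sum_padZero {m : ℕ} {M : Type*} [AddCommMonoid M] (φ : Fin (m + 1) → ℂ) (f : ℂ → ℕ → M)
    (hf : ∀ j, f 0 j = 0) : ∑ j, f (padZero φ j) j = ∑ a, f (φ a) a := by
  have h : (2 * m + 1) = (m + 1) + m := by ring
  rw [← (finCongr h).symm.sum_comp, Fin.sum_univ_add]
  have h2 : ∀ i : Fin m, f (padZero φ ((finCongr h).symm (Fin.natAdd (m + 1) i)))
      ((finCongr h).symm (Fin.natAdd (m + 1) i)) = 0 := by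
    intro i
    rw [padZero, dif_neg (by simp; omega), hf]
  rw [Finset.sum_congr rfl fun i _ => h2 i, Finset.sum_const_zero, add_zero]
  refine Finset.sum_congr rfl fun i _ => ?_
  rw [padZero, dif_pos (by simp; omega)]
  simp

lemma dft_convSq {m : ℕ} (φ : Fin (m + 1) → ℂ) (k : Fin (2 * m + 1)) :
    dft (convSq φ) k = (Real.sqrt (((2 * m : ℕ) : ℝ) + 1) : ℂ) * dft (padZero φ) k ^ 2 := by
  rw [dft_eq, dft_eq, sum_convSq_mul φ (fun j => chi (2 * m) k j),
    sum_padZero φ (fun c j => c * chi (2 * m) k j) (by simp), mul_pow, pow_two (∑ a, _),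
    Finset.sum_mul_sum]
  have hs : (Real.sqrt (((2 * m : ℕ) : ℝ) + 1) : ℂ) ≠ 0 := by
    rw [Complex.ofReal_ne_zero]; positivity
  rw [← mul_assoc]
  congr 1
  · rw [Complex.ofReal_div]
    field_simp
    simp
  · refine Finset.sum_congr rfl fun a _ => Finset.sum_congr rfl fun b _ => ?_
    rw [chi_add]; ring

/-- Squaring the transform turns its ℓ₁ norm into a squared ℓ₂ norm, to which Parseval applies. A
bound on the variance of φ thus becomes feasibility of φ * φ. -/
lemma specNorm1_convSq {m : ℕ} (φ : Fin (m + 1) → ℂ) :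
    specNorm1 (convSq φ) = Real.sqrt (((2 * m : ℕ) : ℝ) + 1) * ∑ a, ‖φ a‖ ^ 2 := by
  rw [specNorm1]
  simp_rw [dft_convSq, norm_mul, norm_pow]
  rw [← Finset.mul_sum, parseval, sum_padZero φ (fun c _ => ‖c‖ ^ 2) (by simp)]
  rw [Complex.norm_real, Real.norm_eq_abs, abs_of_nonneg (Real.sqrt_nonneg _)]

end Convolution

/-! ### Restriction to the window, and bounds that are linear in the filter. -/

section Restriction

/-- Restriction of a two-sided sequence to `[0, n]`. -/
def res (n : ℕ) : (ℤ → ℂ) →ₗ[ℂ] EuclideanSpace ℂ (Fin (n + 1)) where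
  toFun u := WithLp.toLp 2 fun t => u (t : ℕ)
  map_add' _ _ := rfl
  map_smul' _ _ := rfl

@[simp] lemma res_apply (n : ℕ) (u : ℤ → ℂ) (t : Fin (n + 1)) : res n u t = u (t : ℕ) := rfl

lemma norm_res (n : ℕ) (u : ℤ → ℂ) : ‖res n u‖ = norm2 n u := by
  rw [EuclideanSpace.norm_eq, norm2,
    ← Fin.sum_univ_eq_sum_range (fun t : ℕ => ‖u (t : ℤ)‖ ^ 2) (n + 1)]
  rfl

lemma norm_res_le {n : ℕ} {u : ℤ → ℂ} {c : ℝ} (hc : 0 ≤ c)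
    (h : ∀ t : Fin (n + 1), ‖u (t : ℕ)‖ ≤ c) : ‖res n u‖ ≤ Real.sqrt ((n : ℝ) + 1) * c := by
  rw [EuclideanSpace.norm_eq]
  refine Real.sqrt_le_iff.2 ⟨by positivity, ?_⟩
  rw [mul_pow, Real.sq_sqrt (by positivity)]
  refine (Finset.sum_le_sum fun t _ => pow_le_pow_left₀ (norm_nonneg _) (h t) 2).trans ?_
  simp

/-- Convexity of the norm: a linear quantity on a spectral ball is controlled by its values at the
atoms. T is a point evaluation in one use and an inner product with the noise in the other. -/
lemma norm_apply_le_specNorm1_mul {G : Type*} [SeminormedAddCommGroup G] [NormedSpace ℂ G]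
    {n : ℕ} (T : (ℤ → ℂ) →ₗ[ℂ] G) (φ : Fin (n + 1) → ℂ) (u : ℤ → ℂ) {c r : ℝ}
    (hc : 0 ≤ c) (hφ : specNorm1 φ ≤ r) (h : ∀ k, ‖T (conv (atom n k) u)‖ ≤ c) :
    ‖T (conv φ u)‖ ≤ r * c := by
  rw [conv_eq_sum_atom, map_sum]
  refine (norm_sum_le _ _).trans ?_
  calc ∑ k, ‖T (dft φ k • conv (atom n k) u)‖ ≤ ∑ k, ‖dft φ k‖ * c := by
        refine Finset.sum_le_sum fun k _ => ?_
        rw [map_smul, norm_smul]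
        exact mul_le_mul_of_nonneg_left (h k) (norm_nonneg _)
    _ = specNorm1 φ * c := by rw [← Finset.sum_mul, specNorm1]
    _ ≤ r * c := mul_le_mul_of_nonneg_right hφ hc

lemma norm_conv_le {k : ℕ} (φ : Fin (k + 1) → ℂ) (u : ℤ → ℂ) (t : ℤ) {c : ℝ}
    (h : ∀ j : Fin (k + 1), ‖u (t - (j : ℕ))‖ ≤ c) : ‖conv φ u t‖ ≤ (∑ j, ‖φ j‖) * c := by
  rw [conv, Finset.sum_mul]
  refine (norm_sum_le _ _).trans (Finset.sum_le_sum fun j _ => ?_)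
  rw [norm_mul]
  exact mul_le_mul_of_nonneg_left (h j) (norm_nonneg _)

lemma norm_sum_mul_le_sqrt {κ : Type*} [Fintype κ] (a b : κ → ℂ) :
    ‖∑ i, a i * b i‖ ≤ Real.sqrt (∑ i, ‖a i‖ ^ 2) * Real.sqrt (∑ i, ‖b i‖ ^ 2) := by
  refine (norm_sum_le _ _).trans ?_
  simp_rw [norm_mul]
  exact Real.sum_mul_le_sqrt_mul_sqrt _ _ _

lemma norm_sum_mul_le {κ : Type*} [Fintype κ] (a b : κ → ℂ) {A B : ℝ} (hA : 0 ≤ A) (hB : 0 ≤ B)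
    (ha : ∑ i, ‖a i‖ ^ 2 ≤ A ^ 2) (hb : ∑ i, ‖b i‖ ^ 2 ≤ B ^ 2) :
    ‖∑ i, a i * b i‖ ≤ A * B := by
  refine (norm_sum_mul_le_sqrt a b).trans ?_
  gcongr
  · exact Real.sqrt_le_iff.2 ⟨hA, ha⟩
  · exact Real.sqrt_le_iff.2 ⟨hB, hb⟩

end Restriction

/-! ### The deterministic argument for a fixed noise realization. -/

section Deterministic

/-- Xo and Xh stand for x - θ * x, and zo and zh for θ * ζ, with θ the comparison filter and the
optimal one respectively; w is the projected noise. After expansion ‖σz‖² cancels, and the only term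
involving the unknown Xh is linear in it, so a quadratic inequality closes the bound. -/
lemma norm_le_of_residual_le {H : Type*} [NormedAddCommGroup H] [InnerProductSpace ℂ H]
    {z w Xo zo Xh zh : H} {r : ℂ} {σ Q : ℝ} (hσ : 0 < σ) (hQ : 0 ≤ Q)
    (h0 : ‖Xh - (σ : ℂ) • zh + (σ : ℂ) • z‖ ≤ ‖Xo - (σ : ℂ) • zo + (σ : ℂ) • z‖)
    (hXo : ‖Xo‖ ≤ 4 * σ * Q) (hzo : ‖zo‖ ≤ 12 * Q) (hzh : ‖zh‖ ≤ 12 * Q)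
    (hzXo : ‖inner ℂ z Xo‖ ≤ 19 * σ * Q ^ 2) (hzzo : ‖inner ℂ z zo‖ ≤ 114 * Q ^ 2)
    (hzzh : ‖inner ℂ z zh‖ ≤ 114 * Q ^ 2) (hr : inner ℂ z Xh = inner ℂ w Xh + r)
    (hw : ‖w‖ ≤ 4 * Q) (hrn : ‖r‖ ≤ 15 * σ * Q ^ 2) : ‖Xh‖ ≤ 46 * σ * Q := by
  have hsq := pow_le_pow_left₀ (norm_nonneg _) h0 2
  rw [@norm_add_sq ℂ, @norm_add_sq ℂ] at hsq
  set d := ‖Xh - (σ : ℂ) • zh‖ with hd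
  set D := ‖Xo - (σ : ℂ) • zo‖ with hD
  have hσn : ‖(σ : ℂ)‖ = σ := by rw [Complex.norm_real, Real.norm_eq_abs, abs_of_pos hσ]
  have hDle : D ≤ 16 * σ * Q := by
    refine (norm_sub_le _ _).trans ?_
    rw [norm_smul, hσn]
    nlinarith
  have hXh : ‖Xh‖ ≤ d + σ * (12 * Q) := by
    have : Xh = (Xh - (σ : ℂ) • zh) + (σ : ℂ) • zh := by abel
    rw [this]
    refine (norm_add_le _ _).trans ?_
    rw [norm_smul, hσn]
    gcongr
  have bound : ∀ (X Z : H) (p q : ℝ), ‖inner ℂ z X‖ ≤ p → ‖inner ℂ z Z‖ ≤ q →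
      |RCLike.re (inner ℂ (X - (σ : ℂ) • Z) ((σ : ℂ) • z))| ≤ σ * (p + σ * q) := by
    intro X Z p q hp hq
    refine (RCLike.abs_re_le_norm _).trans ?_
    rw [inner_smul_right, norm_mul, hσn, norm_inner_symm, inner_sub_right, inner_smul_right]
    refine mul_le_mul_of_nonneg_left ((norm_sub_le _ _).trans ?_) hσ.le
    rw [norm_mul, hσn]
    gcongr
  have b1 := bound Xo zo _ _ hzXo hzzo
  have hzXh : ‖inner ℂ z Xh‖ ≤ 4 * Q * (d + σ * (12 * Q)) + 15 * σ * Q ^ 2 := by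
    rw [hr]
    refine (norm_add_le _ _).trans (add_le_add ((norm_inner_le_norm _ _).trans ?_) hrn)
    exact mul_le_mul hw hXh (norm_nonneg _) (by positivity)
  have b2 := bound Xh zh _ _ hzXh hzzh
  have c1 := (abs_le.1 b1).2
  have c2 := (abs_le.1 b2).1
  have hd0 : 0 ≤ d := norm_nonneg _
  have hD2 : D ^ 2 ≤ (16 * σ * Q) ^ 2 := pow_le_pow_left₀ (norm_nonneg _) hDle 2
  -- 876 = 16² + 2(19 + 114) + 2(48 + 15 + 114). The value 34 below works since 34² exceeds 876 +
  -- 8·34, and 34 + 12 = 46.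
  have hmain : d ^ 2 ≤ 876 * (σ * Q) ^ 2 + 8 * (σ * Q) * d := by
    nlinarith
  have hdle : d ≤ 34 * (σ * Q) := by
    have h0 : 0 ≤ σ * Q := by positivity
    by_contra hcon
    push Not at hcon
    nlinarith
  linarith

variable {m : ℕ}

lemma sum_norm_le_of_sum_sq (φ : Fin (m + 1) → ℂ) {ρ : ℝ} (hρ : 0 ≤ ρ)
    (hφ : ∑ j, ‖φ j‖ ^ 2 ≤ ρ ^ 2 / (2 * ((m : ℝ) + 1))) : ∑ j, ‖φ j‖ ≤ ρ := by
  have h := sq_sum_le_card_mul_sum_sq (s := Finset.univ) (f := fun j => ‖φ j‖)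
  rw [Finset.card_univ, Fintype.card_fin] at h
  refine abs_le_of_sq_le_sq' ?_ hρ |>.2
  refine h.trans ?_
  push_cast
  calc ((m : ℝ) + 1) * ∑ j, ‖φ j‖ ^ 2 ≤ ((m : ℝ) + 1) * (ρ ^ 2 / (2 * ((m : ℝ) + 1))) := by gcongr
    _ = ρ ^ 2 / 2 := by field_simp
    _ ≤ ρ ^ 2 := by nlinarith [sq_nonneg ρ]

/-- As 2m + 1 ≤ 2(m + 1), the norm is in fact at most ρ²/√(2m+1); the radius 2ρ² leaves a factor 2
of slack. -/
lemma specNorm1_convSq_le (φ : Fin (m + 1) → ℂ) {ρ : ℝ}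
    (hφ : ∑ j, ‖φ j‖ ^ 2 ≤ ρ ^ 2 / (2 * ((m : ℝ) + 1))) :
    specNorm1 (convSq φ) ≤ 2 * ρ ^ 2 / Real.sqrt (((2 * m : ℕ) : ℝ) + 1) := by
  rw [specNorm1_convSq]
  have h0 : (0 : ℝ) < ((2 * m : ℕ) : ℝ) + 1 := by positivity
  rw [le_div_iff₀ (Real.sqrt_pos.2 h0), mul_right_comm, Real.mul_self_sqrt h0.le]
  calc (((2 * m : ℕ) : ℝ) + 1) * ∑ j, ‖φ j‖ ^ 2
      ≤ (2 * ((m : ℝ) + 1)) * (ρ ^ 2 / (2 * ((m : ℝ) + 1))) := by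
        refine mul_le_mul ?_ hφ (Finset.sum_nonneg fun _ _ => sq_nonneg _) (by positivity)
        push_cast; linarith
    _ = ρ ^ 2 := by field_simp
    _ ≤ 2 * ρ ^ 2 := by nlinarith [sq_nonneg ρ]

lemma norm_sub_convSq_le (x : ℤ → ℂ) (φ : Fin (m + 1) → ℂ) {ρ b : ℝ} (hρ : 1 ≤ ρ) (hb0 : 0 ≤ b)
    (hφ : ∑ j, ‖φ j‖ ^ 2 ≤ ρ ^ 2 / (2 * ((m : ℝ) + 1)))
    (hb : ∀ τ ∈ Set.Icc (-(m : ℤ)) (2 * m), ‖x τ - conv φ x τ‖ ≤ b)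
    (t : Fin (2 * m + 1)) : ‖(x - conv (convSq φ) x) (t : ℕ)‖ ≤ 2 * ρ * b := by
  -- The second term reaches back to times t - j ≥ -m, which is why simplicity is required from -m
  -- onwards.
  have hdec : x - conv (convSq φ) x = (x - conv φ x) + conv φ (x - conv φ x) := by
    rw [conv_convSq, conv_sub]; abel
  have ht := t.2
  rw [hdec]
  refine (norm_add_le _ _).trans ?_
  have h1 : ‖(x - conv φ x) (t : ℕ)‖ ≤ b := hb _ ⟨by omega, by omega⟩
  have h2 : ‖conv φ (x - conv φ x) (t : ℕ)‖ ≤ (∑ j, ‖φ j‖) * b := by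
    refine norm_conv_le _ _ _ fun j => hb _ ⟨?_, ?_⟩
    · have := j.2; omega
    · omega
  have h3 := sum_norm_le_of_sum_sq φ (by linarith) hφ
  nlinarith

lemma norm_res_sub_convSq_le (x : ℤ → ℂ) (φ : Fin (m + 1) → ℂ) {σ ρ : ℝ} (hσ : 0 < σ) (hρ : 1 ≤ ρ)
    (hφ : ∑ j, ‖φ j‖ ^ 2 ≤ ρ ^ 2 / (2 * ((m : ℝ) + 1)))
    (hb : ∀ τ ∈ Set.Icc (-(m : ℤ)) (2 * m),
      ‖x τ - conv φ x τ‖ ≤ σ * ρ / Real.sqrt ((m : ℝ) + 1)) :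
    ‖res (2 * m) (x - conv (convSq φ) x)‖ ≤ 3 * σ * ρ ^ 2 := by
  have hs : 0 < Real.sqrt ((m : ℝ) + 1) := Real.sqrt_pos.2 (by positivity)
  have h := norm_res_le (by positivity) (norm_sub_convSq_le x φ hρ (by positivity) hφ hb)
  refine h.trans ?_
  have h1 : Real.sqrt (((2 * m : ℕ) : ℝ) + 1) ≤ 3 / 2 * Real.sqrt ((m : ℝ) + 1) := by
    refine Real.sqrt_le_iff.2 ⟨by positivity, ?_⟩
    rw [mul_pow, Real.sq_sqrt (by positivity)]
    push_cast
    have : (0 : ℝ) ≤ m := by positivity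
    linarith
  calc Real.sqrt (((2 * m : ℕ) : ℝ) + 1) * (2 * ρ * (σ * ρ / Real.sqrt ((m : ℝ) + 1)))
      ≤ (3 / 2 * Real.sqrt ((m : ℝ) + 1)) * (2 * ρ * (σ * ρ / Real.sqrt ((m : ℝ) + 1))) := by gcongr
    _ = 3 * σ * ρ ^ 2 := by field_simp

/-- The error at the right end of the window for a realization of the noise satisfying the
listed inequalities. -/
lemma norm_error_le_of_good_noise (x xS ε u : ℤ → ℂ) (S : Submodule ℂ (ℤ → ℂ))
    (hS : S.map shift = S) (hxS : xS ∈ S) (hx : x = xS + ε)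
    {V : Submodule ℂ (EuclideanSpace ℂ (Fin (2 * m + 1)))} (hV : V = S.map (res (2 * m)))
    {σ ρ ϰ L L' Q : ℝ} (hσ : 0 < σ) (hρ : 1 ≤ ρ) (hϰ : 0 ≤ ϰ) (hL : 0 ≤ L)
    (hQ : 0 ≤ Q) (hQL : ρ ^ 2 * Real.sqrt L ≤ Q) (hQρ : ρ ^ 2 ≤ 4 / 3 * Q)
    (hQϰ : ρ ^ 2 * (ϰ * Real.sqrt L') ≤ Q ^ 2)
    (φ : Fin (m + 1) → ℂ)
    (hφ : ∑ j, ‖φ j‖ ^ 2 ≤ ρ ^ 2 / (2 * ((m : ℝ) + 1)))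
    (hb : ∀ τ ∈ Set.Icc (-(m : ℤ)) (2 * m),
      ‖x τ - conv φ x τ‖ ≤ σ * ρ / Real.sqrt ((m : ℝ) + 1))
    (h1 : ∀ k t : Fin (2 * m + 1), ‖conv (atom (2 * m) k) u (t : ℕ)‖ ≤ 6 * Real.sqrt L)
    (h2 : ∀ k, ‖inner ℂ (res (2 * m) u) (res (2 * m) (conv (atom (2 * m) k) u))‖
      ≤ 57 * Real.sqrt (((2 * m : ℕ) : ℝ) + 1) * L)
    (h3 : ‖V.starProjection (res (2 * m) u)‖ ≤ 4 * Q)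
    (h4 : ‖inner ℂ (res (2 * m) u) (res (2 * m) (x - conv (convSq φ) x))‖
      ≤ 14 * σ * ρ ^ 2 * Real.sqrt L)
    (h5 : ‖inner ℂ (res (2 * m) u - V.starProjection (res (2 * m) u)) (res (2 * m) ε)‖
      ≤ 5 * σ * ϰ * Real.sqrt L')
    (h6 : ∑ j : Fin (2 * m + 1), ‖inner ℂ (res (2 * m) u - V.starProjection (res (2 * m) u))
      (res (2 * m) ((shift ^ (j : ℕ)) ε))‖ ^ 2
      ≤ (((2 * m : ℕ) : ℝ) + 1) * (5 * σ * ϰ * Real.sqrt L') ^ 2)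
    (ψ : Fin (2 * m + 1) → ℂ)
    (hψ : IsConstrainedOptimal (2 * m) (2 * ρ ^ 2) (x + (σ : ℂ) • u) ψ) :
    ‖x ((2 * m : ℕ) : ℤ) - conv ψ (x + (σ : ℂ) • u) ((2 * m : ℕ) : ℤ)‖
      ≤ 80 * (σ * ρ / Real.sqrt ((m : ℝ) + 1)) * Q := by
  obtain ⟨hψ1, hψ2⟩ := hψ
  set N : ℝ := ((2 * m : ℕ) : ℝ) + 1 with hN
  have hN0 : 0 < N := by positivity
  have hsN : 0 < Real.sqrt N := Real.sqrt_pos.2 hN0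
  have hsm : 0 < Real.sqrt ((m : ℝ) + 1) := Real.sqrt_pos.2 (by positivity)
  have hNN := Real.mul_self_sqrt hN0.le
  set z := res (2 * m) u with hz
  set w := V.starProjection z with hw
  set bb := σ * ρ / Real.sqrt ((m : ℝ) + 1) with hbb
  have hbb0 : 0 ≤ bb := by positivity
  have hsL := Real.sqrt_nonneg L
  have hLs := Real.mul_self_sqrt hL
  have hfeas := specNorm1_convSq_le φ hφ
  have hres : ∀ θ : Fin (2 * m + 1) → ℂ,
      res (2 * m) ((x + (σ : ℂ) • u) - conv θ (x + (σ : ℂ) • u))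
        = res (2 * m) (x - conv θ x) - (σ : ℂ) • res (2 * m) (conv θ u) + (σ : ℂ) • z := by
    intro θ
    rw [conv_add, conv_smul, hz]
    simp only [map_sub, map_add, map_smul]
    abel
  -- bounds for an arbitrary feasible filter
  have hpt : ∀ θ : Fin (2 * m + 1) → ℂ, specNorm1 θ ≤ 2 * ρ ^ 2 / Real.sqrt N →
      ∀ t : Fin (2 * m + 1), ‖conv θ u (t : ℕ)‖ ≤ 12 * Q / Real.sqrt N := by
    intro θ hθ t
    have := norm_apply_le_specNorm1_mul (LinearMap.proj ((t : ℕ) : ℤ) : (ℤ → ℂ) →ₗ[ℂ] ℂ) θ u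
      (by positivity) hθ (fun k => h1 k t)
    refine this.trans ?_
    rw [div_mul_eq_mul_div]
    exact div_le_div_of_nonneg_right (by linarith) hsN.le
  have hzθ : ∀ θ : Fin (2 * m + 1) → ℂ, specNorm1 θ ≤ 2 * ρ ^ 2 / Real.sqrt N →
      ‖res (2 * m) (conv θ u)‖ ≤ 12 * Q := by
    intro θ hθ
    refine (norm_res_le (by positivity) (hpt θ hθ)).trans (le_of_eq ?_)
    rw [← hN]
    field_simp
  have hQ2 : ρ ^ 2 * L ≤ Q ^ 2 := by
    have h := mul_self_le_mul_self (by positivity) hQL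
    have hρ1 : (1 : ℝ) ≤ ρ ^ 2 := one_le_pow₀ hρ
    have : ρ ^ 2 * L ≤ ρ ^ 2 * (ρ ^ 2 * L) :=
      le_mul_of_one_le_left (by positivity) hρ1
    have e : ρ ^ 2 * (ρ ^ 2 * L) = (ρ ^ 2 * Real.sqrt L) * (ρ ^ 2 * Real.sqrt L) := by
      rw [← hLs, Real.sqrt_mul_self hsL]; ring
    linarith
  have hzzθ : ∀ θ : Fin (2 * m + 1) → ℂ, specNorm1 θ ≤ 2 * ρ ^ 2 / Real.sqrt N →
      ‖inner ℂ z (res (2 * m) (conv θ u))‖ ≤ 114 * Q ^ 2 := by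
    intro θ hθ
    have := norm_apply_le_specNorm1_mul ((innerₛₗ ℂ z).comp (res (2 * m))) θ u
      (by positivity) hθ h2
    refine this.trans ?_
    have e : 2 * ρ ^ 2 / Real.sqrt N * (57 * Real.sqrt N * L) = 114 * (ρ ^ 2 * L) := by
      field_simp; ring
    rw [e]
    linarith
  -- the residual of the deterministic part
  have hρ1 : (1 : ℝ) ≤ ρ ^ 2 := one_le_pow₀ hρ
  have hϰL : 0 ≤ ϰ * Real.sqrt L' := by positivity
  have hQϰ1 : ϰ * Real.sqrt L' ≤ Q ^ 2 :=
    (le_mul_of_one_le_left hϰL hρ1).trans hQϰ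
  have hr : inner ℂ z (res (2 * m) (x - conv ψ x)) = inner ℂ w (res (2 * m) (x - conv ψ x))
      + inner ℂ (z - w) (res (2 * m) (ε - conv ψ ε)) := by
    -- The component z - w of the noise is orthogonal to V, so the part of the residual coming from
    -- x^S drops out and only ε is left.
    have hmem : res (2 * m) (xS - conv ψ xS) ∈ V := by
      rw [hV]
      exact Submodule.mem_map_of_mem (S.sub_mem hxS (conv_mem hS hxS ψ))
    have h0 : inner ℂ (z - w) (res (2 * m) (xS - conv ψ xS)) = 0 :=
      Submodule.inner_left_of_mem_orthogonal hmem (V.sub_starProjection_mem_orthogonal z)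
    have hsplit : res (2 * m) (x - conv ψ x) = res (2 * m) (xS - conv ψ xS)
        + res (2 * m) (ε - conv ψ ε) := by
      rw [hx, conv_add, ← map_add]
      congr 1
      abel
    have h7 : inner ℂ (z - w) (res (2 * m) (ε - conv ψ ε))
        = inner ℂ (z - w) (res (2 * m) (x - conv ψ x)) := by
      rw [hsplit, inner_add_right, h0, zero_add]
    rw [h7, inner_sub_left]
    ring
  have hrn : ‖inner ℂ (z - w) (res (2 * m) (ε - conv ψ ε))‖ ≤ 15 * σ * Q ^ 2 := by
    rw [map_sub, inner_sub_right]
    refine (norm_sub_le _ _).trans ?_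
    -- Cauchy–Schwarz separates the random ψ, with ‖ψ‖₂ ≤ `specNorm1 ψ`, from the correlations of
    -- the noise with the fixed shifts of ε.
    have h8 : ‖inner ℂ (z - w) (res (2 * m) (conv ψ ε))‖
        ≤ (2 * ρ ^ 2 / Real.sqrt N) * (Real.sqrt N * (5 * σ * ϰ * Real.sqrt L')) := by
      rw [conv_eq_sum_shift, map_sum, inner_sum]
      simp_rw [map_smul, inner_smul_right]
      refine norm_sum_mul_le _ _ (by positivity) (by positivity) ?_ ?_
      · exact (sum_norm_sq_le_specNorm1 ψ).trans
          (pow_le_pow_left₀ (specNorm1_nonneg _) hψ1 2)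
      · rw [mul_pow, Real.sq_sqrt hN0.le]; exact h6
    have e : (2 * ρ ^ 2 / Real.sqrt N) * (Real.sqrt N * (5 * σ * ϰ * Real.sqrt L'))
        = 10 * σ * (ρ ^ 2 * (ϰ * Real.sqrt L')) := by field_simp; ring
    rw [e] at h8
    have h9 : 5 * σ * ϰ * Real.sqrt L' ≤ 5 * σ * Q ^ 2 := by
      have := mul_le_mul_of_nonneg_left hQϰ1 hσ.le
      linarith
    have := mul_le_mul_of_nonneg_left hQϰ hσ.le
    linarith
  have hl2 : ‖res (2 * m) (x - conv ψ x)‖ ≤ 46 * σ * Q := by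
    refine norm_le_of_residual_le hσ hQ (z := z) (w := w) ?_ ?_ (hzθ _ hfeas) (hzθ _ hψ1) ?_
      (hzzθ _ hfeas) (hzzθ _ hψ1) hr h3 hrn
      (Xo := res (2 * m) (x - conv (convSq φ) x))
    · rw [← hres, ← hres, norm_res, norm_res]
      exact hψ2 _ hfeas
    · refine (norm_res_sub_convSq_le x φ hσ hρ hφ hb).trans ?_
      have := mul_le_mul_of_nonneg_left hQρ hσ.le
      linarith
    · refine h4.trans ?_
      have : ρ ^ 2 * Real.sqrt L ≤ 4 / 3 * Q ^ 2 := by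
        have : 1 * Q ≤ (4 / 3 * Q) * Q := mul_le_mul_of_nonneg_right (hρ1.trans hQρ) hQ
        linarith
      have := mul_le_mul_of_nonneg_left this hσ.le
      have : 0 ≤ σ * Q ^ 2 := by positivity
      linarith
  -- the pointwise error
  have hend : ((2 * m : ℕ) : ℤ) = ((Fin.last (2 * m) : Fin (2 * m + 1)) : ℕ) := by simp
  -- Commutation of φ and ψ lets φ act on x - ψ * x, whose ℓ₂ norm is known, while ψ acts only on
  -- the uniformly small x - φ * x and on the noise.
  have hdec : x ((2 * m : ℕ) : ℤ) - conv ψ (x + (σ : ℂ) • u) ((2 * m : ℕ) : ℤ)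
      = conv φ (x - conv ψ x) ((2 * m : ℕ) : ℤ)
        + ((x - conv φ x) ((2 * m : ℕ) : ℤ) - conv ψ (x - conv φ x) ((2 * m : ℕ) : ℤ))
        - σ * conv ψ u ((2 * m : ℕ) : ℤ) := by
    rw [conv_add, conv_smul, conv_sub, conv_sub, conv_comm φ ψ]
    simp only [Pi.add_apply, Pi.sub_apply, Pi.smul_apply, smul_eq_mul]
    ring
  -- The times 2m - j with j ≤ m are distinct and lie in the window, so the ℓ₂ bound on [0, 2m]
  -- suffices.
  have e1 : ‖conv φ (x - conv ψ x) ((2 * m : ℕ) : ℤ)‖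
      ≤ (ρ / Real.sqrt ((m : ℝ) + 1)) * (46 * σ * Q) := by
    refine norm_sum_mul_le _ _ (by positivity) (by positivity) ?_ ?_
    · refine hφ.trans ?_
      rw [div_pow, Real.sq_sqrt (by positivity)]
      gcongr
      have : (0 : ℝ) ≤ m := by positivity
      linarith
    · refine le_trans ?_ (pow_le_pow_left₀ (norm_nonneg _) hl2 2)
      rw [EuclideanSpace.norm_sq_eq]
      have hinj : Function.Injective
          (fun j : Fin (m + 1) => (⟨2 * m - j, by omega⟩ : Fin (2 * m + 1))) := by
        intro a b hab
        have ha := a.2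
        have hb' := b.2
        have := congrArg Fin.val hab
        simp only at this
        exact Fin.ext (by omega)
      have hsum := Finset.sum_le_univ_sum_of_nonneg
        (f := fun t : Fin (2 * m + 1) => ‖res (2 * m) (x - conv ψ x) t‖ ^ 2)
        (s := Finset.univ.map ⟨_, hinj⟩) (fun t => sq_nonneg _)
      rw [Finset.sum_map] at hsum
      refine le_trans (le_of_eq (Finset.sum_congr rfl fun j _ => ?_)) hsum
      have hj := j.2
      simp only [Function.Embedding.coeFn_mk, res_apply]
      rw [Nat.cast_sub (by omega)]
  have e2 : ‖(x - conv φ x) ((2 * m : ℕ) : ℤ)‖ ≤ bb := hb _ ⟨by omega, by push_cast; omega⟩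
  have e3 : ‖conv ψ (x - conv φ x) ((2 * m : ℕ) : ℤ)‖ ≤ (2 * ρ ^ 2) * bb := by
    refine (norm_conv_le ψ _ _ (c := bb) fun j => hb _ ⟨?_, ?_⟩).trans ?_
    · have := j.2; omega
    · push_cast; omega
    · refine mul_le_mul_of_nonneg_right ((sum_norm_le_specNorm1 ψ).trans ?_) hbb0
      exact (le_div_iff₀ hsN).1 hψ1
  have e4 : ‖σ * conv ψ u ((2 * m : ℕ) : ℤ)‖ ≤ bb * (12 * Q) := by
    rw [norm_mul, Complex.norm_real, Real.norm_eq_abs, abs_of_pos hσ]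
    have h10 := hpt ψ hψ1 (Fin.last _)
    rw [← hend] at h10
    have h11 : Real.sqrt ((m : ℝ) + 1) ≤ Real.sqrt N := by
      refine Real.sqrt_le_sqrt ?_
      rw [hN]; push_cast
      have : (0 : ℝ) ≤ m := by positivity
      linarith
    calc σ * ‖conv ψ u ((2 * m : ℕ) : ℤ)‖ ≤ σ * (12 * Q / Real.sqrt N) := by gcongr
      _ ≤ (σ * ρ) * (12 * Q / Real.sqrt ((m : ℝ) + 1)) := by
          gcongr
          nlinarith
      _ = bb * (12 * Q) := by rw [hbb]; ring
  rw [hdec]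
  refine (norm_sub_le _ _).trans ((add_le_add ((norm_add_le _ _).trans (add_le_add e1
    ((norm_sub_le _ _).trans (add_le_add e2 e3)))) e4).trans ?_)
  have e5 : ρ / Real.sqrt ((m : ℝ) + 1) * (46 * σ * Q) = bb * (46 * Q) := by rw [hbb]; ring
  rw [e5]
  -- The coefficients add up to 46 + 4/3 + 8/3 + 12 = 62, below 80.
  have e6 := mul_le_mul_of_nonneg_left (hρ1.trans hQρ) hbb0
  have e7 := mul_le_mul_of_nonneg_left hQρ hbb0
  have e8 : 0 ≤ bb * Q := by positivity
  linarith

end Deterministic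

/-! ### Chernoff and union bounds. -/

section Events

variable {E : Type*} [NormedAddCommGroup E] [InnerProductSpace ℝ E] [FiniteDimensional ℝ E]
  [MeasurableSpace E] [BorelSpace E]

lemma exists_event_exp_moment {Ω κ : Type*} [MeasurableSpace Ω] {μ : Measure Ω} [Fintype κ]
    [Nonempty κ] (g : κ → Ω → ℝ) (hg : ∀ i, Measurable (g i)) {w δ : ℝ} (hw : 0 < w) (hδ : 0 < δ)
    (h : ∀ i, ∫⁻ z, ENNReal.ofReal (Real.exp (g i z)) ∂μ ≤ ENNReal.ofReal w) :
    ∃ G : Set Ω, MeasurableSet G ∧ μ Gᶜ ≤ ENNReal.ofReal δ ∧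
      ∀ z ∈ G, ∀ i, g i z ≤ Real.log (Fintype.card κ * w / δ) := by
  have hcard : (0 : ℝ) < Fintype.card κ := by exact_mod_cast Fintype.card_pos
  set B : ℝ := Fintype.card κ * w / δ with hB
  have hB0 : 0 < B := by positivity
  refine ⟨⋂ i, {z | g i z < Real.log B}, ?_, ?_, ?_⟩
  · exact MeasurableSet.iInter fun i => measurableSet_lt (hg i) measurable_const
  · rw [Set.compl_iInter]
    refine (measure_iUnion_fintype_le μ _).trans ?_
    have h1 : ∀ i, μ {z | g i z < Real.log B}ᶜ ≤ ENNReal.ofReal (w / B) := by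
      intro i
      have hsub : {z | g i z < Real.log B}ᶜ
          ⊆ {z | ENNReal.ofReal B ≤ ENNReal.ofReal (Real.exp (g i z))} := by
        intro z hz
        simp only [Set.mem_compl_iff, Set.mem_ofPred_eq, not_lt] at hz ⊢
        exact ENNReal.ofReal_le_ofReal ((Real.log_le_iff_le_exp hB0).1 hz)
      refine (measure_mono hsub).trans ?_
      refine (meas_ge_le_lintegral_div (hg i).exp.ennreal_ofReal.aemeasurable
        (by simpa using hB0) ENNReal.ofReal_ne_top).trans ?_
      rw [ENNReal.ofReal_div_of_pos hB0]
      exact ENNReal.div_le_div_right (h i) _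
    refine (Finset.sum_le_sum fun i _ => h1 i).trans (le_of_eq ?_)
    rw [Finset.sum_const, Finset.card_univ, nsmul_eq_mul, ← ENNReal.ofReal_natCast,
      ← ENNReal.ofReal_mul hcard.le]
    congr 1
    rw [hB]
    field_simp
  · intro z hz i
    exact (Set.mem_iInter.1 hz i).le

/-- The sum is treated as one random variable, through the exponential moment with equal weights. No
union bound over κ is taken, so the logarithm is free of the cardinality; this keeps ln n out of the
ϰ term of the risk. -/
lemma exists_event_sum_sq {κ : Type*} [Fintype κ] [Nonempty κ] (T : κ → E →L[ℝ] ℂ) {c δ : ℝ}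
    (hc : 0 ≤ c) (hT : ∀ j z, ‖T j z‖ ≤ c * ‖z‖) (hδ : 0 < δ) :
    ∃ G : Set E, MeasurableSet G ∧ stdGaussian E Gᶜ ≤ ENNReal.ofReal δ ∧
      ∀ z ∈ G, ∑ j, ‖T j z‖ ^ 2 ≤ 4 * Fintype.card κ * c ^ 2 * Real.log (2 / δ) := by
  -- The degenerate case is separate because the normalization divides by c.
  rcases eq_or_lt_of_le hc with h0 | h0
  · refine ⟨Set.univ, MeasurableSet.univ, by simp, fun z _ => ?_⟩
    have hz : ∀ j, ‖T j z‖ = 0 := fun j =>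
      le_antisymm (by simpa [← h0] using hT j z) (norm_nonneg _)
    simp [hz, ← h0]
  have hcard : (0 : ℝ) < Fintype.card κ := by exact_mod_cast Fintype.card_pos
  set a : ℝ := (c * Real.sqrt (Fintype.card κ))⁻¹ with ha
  have ha0 : 0 < a := by positivity
  have ha2 : a ^ 2 = 1 / (c ^ 2 * Fintype.card κ) := by
    rw [ha, inv_pow, mul_pow, Real.sq_sqrt hcard.le, one_div]
  have hint := lintegral_exp_sum_sq (F := ℂ) Complex.finrank_real_complex (fun j => a • T j)
    (fun _ => a * c) (fun j z => by
      rw [_root_.smul_apply, norm_smul, Real.norm_eq_abs, abs_of_pos ha0, mul_assoc]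
      exact mul_le_mul_of_nonneg_left (hT j z) ha0.le) (fun _ => by positivity)
    (by
      rw [Finset.sum_const, Finset.card_univ, nsmul_eq_mul, mul_pow, ha2]
      field_simp
      rfl)
  obtain ⟨G, hG, hGm, hGb⟩ := exists_event_exp_moment (κ := Unit) (w := 2)
    (fun _ z => (∑ j, ‖(a • T j) z‖ ^ 2) / 4) (fun _ => by fun_prop) two_pos hδ
    (fun _ => by simpa using hint)
  refine ⟨G, hG, hGm, fun z hz => ?_⟩
  have h1 := hGb z hz ()
  simp only [Fintype.card_unit, Nat.cast_one, one_mul, _root_.smul_apply, norm_smul,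
    mul_pow, Real.norm_eq_abs, sq_abs, ha2] at h1
  rw [← Finset.mul_sum, div_le_iff₀ (by norm_num), div_mul_eq_mul_div, one_mul,
    div_le_iff₀ (by positivity)] at h1
  linarith

end Events

/-! ### High-probability events on the space of noise realizations. -/

section NoiseSpace

/-- The real Hilbert space of noise realizations on `[-n, n]`. -/
abbrev NoiseSpace (n : ℕ) : Type := EuclideanSpace ℂ (Set.Icc (-(n : ℤ)) n)

open scoped Classical in
/-- Extension of a noise realization by zero to a two-sided sequence. -/
def extendZero (n : ℕ) : NoiseSpace n →ₗ[ℂ] (ℤ → ℂ) where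
  toFun z := fun τ => if h : τ ∈ Set.Icc (-(n : ℤ)) n then z ⟨τ, h⟩ else 0
  map_add' z w := by
    ext τ
    by_cases h : τ ∈ Set.Icc (-(n : ℤ)) n
    · simp only [Pi.add_apply, dif_pos h, PiLp.add_apply]
    · simp only [Pi.add_apply, dif_neg h, add_zero]
  map_smul' c z := by
    ext τ
    by_cases h : τ ∈ Set.Icc (-(n : ℤ)) n
    · simp only [Pi.smul_apply, dif_pos h, PiLp.smul_apply, RingHom.id_apply]
    · simp only [Pi.smul_apply, dif_neg h, smul_zero]

variable {n : ℕ}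

lemma extendZero_of_mem (z : NoiseSpace n) {τ : ℤ} (h : τ ∈ Set.Icc (-(n : ℤ)) n) :
    extendZero n z τ = z ⟨τ, h⟩ := dif_pos h

lemma extendZero_of_notMem (z : NoiseSpace n) {τ : ℤ} (h : τ ∉ Set.Icc (-(n : ℤ)) n) :
    extendZero n z τ = 0 := dif_neg h

lemma sum_norm_sq_extendZero_le (z : NoiseSpace n) {κ : Type*} [Fintype κ] (g : κ → ℤ)
    (hg : Function.Injective g) : ∑ j, ‖extendZero n z (g j)‖ ^ 2 ≤ ‖z‖ ^ 2 := by
  classical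
  rw [EuclideanSpace.norm_sq_eq]
  have h1 : ∑ i, ‖z i‖ ^ 2 = ∑ τ ∈ Finset.univ.map
      (Function.Embedding.subtype (· ∈ Set.Icc (-(n : ℤ)) n)), ‖extendZero n z τ‖ ^ 2 := by
    rw [Finset.sum_map]
    refine Finset.sum_congr rfl fun i _ => ?_
    simp only [Function.Embedding.coe_subtype]
    rw [extendZero_of_mem z i.2]
  have h2 : ∑ j, ‖extendZero n z (g j)‖ ^ 2
      = ∑ τ ∈ Finset.univ.map ⟨g, hg⟩, ‖extendZero n z τ‖ ^ 2 := by
    rw [Finset.sum_map]; rfl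
  rw [h1, h2]
  rw [← Finset.sum_filter_of_ne (p := (· ∈ Finset.univ.map
    (Function.Embedding.subtype (· ∈ Set.Icc (-(n : ℤ)) n)))) fun τ _ hne => ?_]
  · exact Finset.sum_le_sum_of_subset_of_nonneg (fun τ h => (Finset.mem_filter.1 h).2)
      fun _ _ _ => sq_nonneg _
  · by_contra hcon
    refine hne ?_
    rw [extendZero_of_notMem z fun hmem =>
      hcon (Finset.mem_map.2 ⟨⟨τ, hmem⟩, Finset.mem_univ _, rfl⟩)]
    simp

/-- Convolution with a filter as a linear map. -/
def convₗ {k : ℕ} (φ : Fin (k + 1) → ℂ) : (ℤ → ℂ) →ₗ[ℂ] (ℤ → ℂ) where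
  toFun := conv φ
  map_add' := conv_add φ
  map_smul' := conv_smul φ

/-- A complex linear map on the noise space as a continuous real linear map. -/
def toRealCLM {G : Type*} [NormedAddCommGroup G] [NormedSpace ℂ G] (T : NoiseSpace n →ₗ[ℂ] G) :
    NoiseSpace n →L[ℝ] G := (LinearMap.toContinuousLinearMap T).restrictScalars ℝ

@[simp] lemma toRealCLM_apply {G : Type*} [NormedAddCommGroup G] [NormedSpace ℂ G]
    (T : NoiseSpace n →ₗ[ℂ] G) (z : NoiseSpace n) : toRealCLM T z = T z := rfl

lemma norm_res_extendZero_le (z : NoiseSpace n) : ‖res n (extendZero n z)‖ ≤ ‖z‖ := by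
  refine abs_le_of_sq_le_sq' ?_ (norm_nonneg _) |>.2
  rw [EuclideanSpace.norm_sq_eq]
  refine sum_norm_sq_extendZero_le z (fun t : Fin (n + 1) => ((t : ℕ) : ℤ)) fun a b h => ?_
  exact Fin.ext (Nat.cast_injective (R := ℤ) h)

lemma norm_conv_atom_extendZero_le (z : NoiseSpace n) (k : Fin (n + 1)) (t : ℤ) :
    ‖conv (atom n k) (extendZero n z) t‖ ≤ ‖z‖ := by
  rw [← one_mul ‖z‖]
  refine norm_sum_mul_le _ _ zero_le_one (norm_nonneg _) (by rw [sum_norm_atom_sq]; simp) ?_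
  refine sum_norm_sq_extendZero_le z (fun j : Fin (n + 1) => t - ((j : ℕ) : ℤ)) fun a b h => ?_
  simp only [sub_right_inj, Nat.cast_inj] at h
  exact Fin.ext h

lemma linear_apply_eq_sum {ι : Type*} [Fintype ι] [DecidableEq ι]
    (T : EuclideanSpace ℂ ι →ₗ[ℂ] ℂ) (z : EuclideanSpace ℂ ι) :
    T z = ∑ i, T (EuclideanSpace.single i 1) * z i := by
  conv_lhs => rw [← (EuclideanSpace.basisFun ι ℂ).sum_repr z, map_sum]
  refine Finset.sum_congr rfl fun i _ => ?_
  rw [map_smul, smul_eq_mul, mul_comm]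
  simp

/-- An atom has unit ℓ₂ norm, so each filtered value is a contraction of the noise into ℂ; the union
runs over (n+1)² pairs. -/
lemma exists_event_conv_atom (n : ℕ) {δ : ℝ} (hδ : 0 < δ) :
    ∃ G : Set (NoiseSpace n), MeasurableSet G ∧ stdGaussian (NoiseSpace n) Gᶜ ≤ ENNReal.ofReal δ ∧
      ∀ z ∈ G, ∀ k t : Fin (n + 1), ‖conv (atom n k) (extendZero n z) (t : ℕ)‖ ^ 2
        ≤ 4 * Real.log (((n : ℝ) + 1) ^ 2 * 2 / δ) := by
  let T : Fin (n + 1) × Fin (n + 1) → NoiseSpace n →L[ℝ] ℂ := fun p => toRealCLM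
    ((LinearMap.proj ((p.2 : ℕ) : ℤ)).comp ((convₗ (atom n p.1)).comp (extendZero n)))
  have hT : ∀ p z, T p z = conv (atom n p.1) (extendZero n z) (p.2 : ℕ) := fun _ _ => rfl
  obtain ⟨G, hG, hGm, hGb⟩ := exists_event_exp_moment (fun p z => ‖T p z‖ ^ 2 / 4)
    (fun p => by fun_prop) two_pos hδ (fun p => by
      have := lintegral_exp_sq_contraction (T p) fun z => by
        rw [hT]; exact norm_conv_atom_extendZero_le z _ _
      rwa [Complex.finrank_real_complex, Real.sq_sqrt (by norm_num)] at this)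
  refine ⟨G, hG, hGm, fun z hz k t => ?_⟩
  have h := hGb z hz (k, t)
  simp only [hT, Fintype.card_prod, Fintype.card_fin] at h
  push_cast at h
  rw [pow_two ((n : ℝ) + 1)]
  linarith

/-- In orthonormal coordinates of V the target has real dimension 2 dim V, so the exponential moment
is at most 2^(dim V). Its logarithm is the source of the √s term. -/
lemma exists_event_projection (V : Submodule ℂ (EuclideanSpace ℂ (Fin (n + 1)))) {δ : ℝ}
    (hδ : 0 < δ) :
    ∃ G : Set (NoiseSpace n), MeasurableSet G ∧ stdGaussian (NoiseSpace n) Gᶜ ≤ ENNReal.ofReal δ ∧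
      ∀ z ∈ G, ‖V.starProjection (res n (extendZero n z))‖ ^ 2
        ≤ 4 * Real.log (2 ^ Module.finrank ℂ V / δ) := by
  let T : NoiseSpace n →L[ℝ] EuclideanSpace ℂ (Fin (Module.finrank ℂ V)) := toRealCLM
    ((stdOrthonormalBasis ℂ V).repr.toLinearEquiv.toLinearMap.comp
      (V.orthogonalProjectionOnto.toLinearMap.comp ((res n).comp (extendZero n))))
  have hT : ∀ z, ‖T z‖ = ‖V.starProjection (res n (extendZero n z))‖ := by
    intro z
    change ‖(stdOrthonormalBasis ℂ V).repr (V.orthogonalProjectionOnto (res n (extendZero n z)))‖ = _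
    rw [LinearIsometryEquiv.norm_map]
    rfl
  have hrank : Module.finrank ℝ (EuclideanSpace ℂ (Fin (Module.finrank ℂ V)))
      = 2 * Module.finrank ℂ V := by
    rw [← Module.finrank_mul_finrank ℝ ℂ, Complex.finrank_real_complex, finrank_euclideanSpace_fin]
  obtain ⟨G, hG, hGm, hGb⟩ := exists_event_exp_moment (κ := Unit) (w := 2 ^ Module.finrank ℂ V)
    (fun _ z => ‖T z‖ ^ 2 / 4)
    (fun _ => by fun_prop) (by positivity) hδ (fun _ => by
      have := lintegral_exp_sq_contraction T fun z => by
        rw [hT]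
        exact (V.norm_starProjection_apply_le _).trans (norm_res_extendZero_le z)
      rwa [hrank, pow_mul, Real.sq_sqrt (by norm_num)] at this)
  refine ⟨G, hG, hGm, fun z hz => ?_⟩
  have h := hGb z hz ()
  simp only [hT, Fintype.card_unit, Nat.cast_one, one_mul] at h
  linarith

lemma real_inner_eq_re_inner {κ : Type*} [Fintype κ] (v w : EuclideanSpace ℂ κ) :
    inner ℝ v w = (inner ℂ v w).re := by
  rw [real_inner_eq_re, PiLp.inner_apply]
  rfl

lemma conv_extendZero_single {k : ℕ} (φ : Fin (k + 1) → ℂ) (i : Set.Icc (-(n : ℤ)) n) (j : Fin (k + 1)) :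
    conv φ (extendZero n (EuclideanSpace.single i 1)) (i + (j : ℕ)) = φ j := by
  rw [conv, Finset.sum_eq_single j]
  · rw [add_sub_cancel_right, extendZero_of_mem _ i.2]
    simp
  · intro l _ hl
    by_cases h : (i : ℤ) + (j : ℕ) - (l : ℕ) ∈ Set.Icc (-(n : ℤ)) n
    · rw [extendZero_of_mem _ h]
      have hne : (⟨(i : ℤ) + (j : ℕ) - (l : ℕ), h⟩ : Set.Icc (-(n : ℤ)) n) ≠ i := by
        intro he
        have := congrArg Subtype.val he
        simp only at this
        exact hl (Fin.ext (by omega))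
      simp [hne]
    · rw [extendZero_of_notMem _ h, mul_zero]
  · simp

/-- The mean is a trace: at each of the n+1 times only the lag-zero coefficient of the atom, of
modulus 1/√(n+1), pairs with the same noise variable. The 2 is E|ζ|². -/
lemma integral_quadratic_le (k : Fin (n + 1)) {c : ℂ} (hc : ‖c‖ = 1) :
    ∫ z, inner ℝ (res n (extendZero n z)) (c • res n (conv (atom n k) (extendZero n z)))
      ∂(stdGaussian (NoiseSpace n)) ≤ 2 * Real.sqrt ((n : ℝ) + 1) := by
  have hmem : ∀ t : Fin (n + 1), ((t : ℕ) : ℤ) ∈ Set.Icc (-(n : ℤ)) n := fun t =>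
    ⟨by omega, by have := t.2; omega⟩
  let T : Fin (n + 1) → NoiseSpace n →ₗ[ℂ] ℂ := fun t =>
    c • ((LinearMap.proj ((t : ℕ) : ℤ)).comp ((convₗ (atom n k)).comp (extendZero n)))
  have hT : ∀ t z, T t z = c * conv (atom n k) (extendZero n z) (t : ℕ) := fun _ _ => rfl
  have hexp : ∀ z : NoiseSpace n,
      inner ℝ (res n (extendZero n z)) (c • res n (conv (atom n k) (extendZero n z)))
      = ∑ t : Fin (n + 1), ((∑ i, T t (EuclideanSpace.single i 1) * z i) *
          (starRingEnd ℂ) (z ⟨_, hmem t⟩)).re := by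
    intro z
    rw [real_inner_eq_re, Complex.re_sum]
    refine Finset.sum_congr rfl fun t _ => ?_
    rw [← linear_apply_eq_sum, hT, res_apply, extendZero_of_mem z (hmem t)]
    simp
  simp_rw [hexp]
  rw [integral_finsetSum _ fun t _ => (integrable_re_conj_mul _ _).1]
  have hval : ∀ t : Fin (n + 1), T t (EuclideanSpace.single ⟨_, hmem t⟩ 1) = c * atom n k 0 := by
    intro t
    rw [hT, ← conv_extendZero_single (atom n k) ⟨_, hmem t⟩ 0]
    simp
  have hle : (c * atom n k 0).re ≤ 1 / Real.sqrt ((n : ℝ) + 1) := by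
    refine (Complex.re_le_norm _).trans ?_
    rw [norm_mul, hc, one_mul, norm_atom]
  calc _ = ∑ t : Fin (n + 1), 2 * (c * atom n k 0).re := by
        refine Finset.sum_congr rfl fun t _ => ?_
        rw [(integrable_re_conj_mul _ _).2, hval]
    _ ≤ ∑ t : Fin (n + 1), 2 * (1 / Real.sqrt ((n : ℝ) + 1)) := by gcongr
    _ = 2 * Real.sqrt ((n : ℝ) + 1) := by
        rw [Finset.sum_const, Finset.card_univ, Fintype.card_fin, nsmul_eq_mul]
        have h := Real.mul_self_sqrt (by positivity : (0 : ℝ) ≤ (n : ℝ) + 1)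
        have h0 : Real.sqrt ((n : ℝ) + 1) ≠ 0 := by positivity
        push_cast
        field_simp
        rw [pow_two, h]

lemma lintegral_exp_quadratic_atom (k : Fin (n + 1)) {c : ℂ} (hc : ‖c‖ = 1) :
    ∫⁻ z, ENNReal.ofReal (Real.exp ((Real.sqrt (8 * ((n : ℝ) + 1)))⁻¹ *
        inner ℝ (res n (extendZero n z)) (c • res n (conv (atom n k) (extendZero n z)))))
      ∂(stdGaussian (NoiseSpace n)) ≤ ENNReal.ofReal (2 * Real.exp 1) := by
  -- This l makes 2l² times a sum of n+1 squared contractions equal to one quarter of a sum whose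
  -- squared bounds (√8·l)² add up to exactly 1. The mean then contributes at most 2/√8 ≤ 1.
  set l : ℝ := (Real.sqrt (8 * ((n : ℝ) + 1)))⁻¹ with hl
  have hl0 : 0 < l := by positivity
  have hl2 : l ^ 2 = 1 / (8 * ((n : ℝ) + 1)) := by
    rw [hl, inv_pow, Real.sq_sqrt (by positivity), one_div]
  refine lintegral_exp_quadratic (toRealCLM ((res n).comp (extendZero n)))
    (toRealCLM (c • ((res n).comp ((convₗ (atom n k)).comp (extendZero n))))) l 1
    norm_res_extendZero_le ?_ ?_
  · let T : Fin (n + 1) → NoiseSpace n →L[ℝ] ℂ := fun t => toRealCLM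
      ((LinearMap.proj ((t : ℕ) : ℤ)).comp ((convₗ (atom n k)).comp (extendZero n)))
    have h8 : Real.sqrt 8 ^ 2 = 8 := Real.sq_sqrt (by norm_num)
    have h := lintegral_exp_sum_sq (F := ℂ) Complex.finrank_real_complex
      (fun t => (Real.sqrt 8 * l) • T t) (fun _ => Real.sqrt 8 * l) (fun t z => by
        rw [_root_.smul_apply, norm_smul, Real.norm_eq_abs, abs_of_nonneg (by positivity)]
        exact mul_le_mul_of_nonneg_left (norm_conv_atom_extendZero_le z k t) (by positivity))
      (fun _ => by positivity) (by
        rw [Finset.sum_const, Finset.card_univ, Fintype.card_fin, nsmul_eq_mul, mul_pow, hl2, h8]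
        push_cast
        field_simp
        rfl)
    refine le_trans (le_of_eq (lintegral_congr fun z => ?_)) h
    congr 2
    have e : ‖toRealCLM (c • ((res n).comp ((convₗ (atom n k)).comp (extendZero n)))) z‖ ^ 2
        = ∑ t, ‖T t z‖ ^ 2 := by
      change ‖c • res n (conv (atom n k) (extendZero n z))‖ ^ 2 = _
      rw [norm_smul, hc, one_mul, EuclideanSpace.norm_sq_eq]
      rfl
    rw [e]
    simp only [_root_.smul_apply, norm_smul, mul_pow, Real.norm_eq_abs, sq_abs, h8]
    rw [← Finset.mul_sum]
    ring
  · refine (mul_le_mul_of_nonneg_left (integral_quadratic_le k hc) hl0.le).trans ?_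
    rw [hl, Real.sqrt_mul (by norm_num), inv_mul_le_iff₀ (by positivity), mul_one]
    gcongr
    exact Real.le_sqrt_of_sq_le (by norm_num)

/-- Four quarter-turns control ±Re and ±Im, so one-sided tail bounds on real quadratic forms suffice
for a complex modulus. -/
lemma norm_le_of_re_I_pow_mul_le {w : ℂ} {B : ℝ} (h : ∀ i : Fin 4, (Complex.I ^ (i : ℕ) * w).re ≤ B) :
    ‖w‖ ≤ 2 * B := by
  have h0 := h 0
  have h1 := h 1
  have h2 := h 2
  have h3 := h 3
  simp [pow_succ] at h0 h1 h2 h3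
  refine (Complex.norm_le_abs_re_add_abs_im w).trans ?_
  have := abs_le.2 ⟨by linarith, h0⟩
  have := abs_le.2 ⟨by linarith, h3⟩
  linarith

lemma exists_event_quadratic_atom (n : ℕ) {δ : ℝ} (hδ : 0 < δ) :
    ∃ G : Set (NoiseSpace n), MeasurableSet G ∧ stdGaussian (NoiseSpace n) Gᶜ ≤ ENNReal.ofReal δ ∧
      ∀ z ∈ G, ∀ k : Fin (n + 1),
        ‖inner ℂ (res n (extendZero n z)) (res n (conv (atom n k) (extendZero n z)))‖
        ≤ 2 * (Real.sqrt (8 * ((n : ℝ) + 1)) *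
          Real.log (((n : ℝ) + 1) * 4 * (2 * Real.exp 1) / δ)) := by
  have hl0 : 0 < Real.sqrt (8 * ((n : ℝ) + 1)) := by positivity
  let q : Fin (n + 1) × Fin 4 → NoiseSpace n → ℝ := fun p z => (Real.sqrt (8 * ((n : ℝ) + 1)))⁻¹ *
    inner ℝ (res n (extendZero n z))
      ((Complex.I ^ (p.2 : ℕ)) • res n (conv (atom n p.1) (extendZero n z)))
  obtain ⟨G, hG, hGm, hGb⟩ := exists_event_exp_moment q (fun p => by
      have hc : Continuous fun z : NoiseSpace n =>
          inner ℝ (toRealCLM ((res n).comp (extendZero n)) z) ((Complex.I ^ (p.2 : ℕ)) •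
            toRealCLM ((res n).comp ((convₗ (atom n p.1)).comp (extendZero n))) z) := by fun_prop
      exact (hc.measurable).const_mul _) (by positivity) hδ
    (fun p => lintegral_exp_quadratic_atom p.1 (by simp))
  refine ⟨G, hG, hGm, fun z hz k => norm_le_of_re_I_pow_mul_le fun i => ?_⟩
  have h := hGb z hz (k, i)
  simp only [q, Fintype.card_prod, Fintype.card_fin] at h
  rw [inv_mul_le_iff₀ hl0, real_inner_eq_re_inner, inner_smul_right] at h
  refine h.trans (le_of_eq ?_)
  push_cast
  rfl

end NoiseSpace

/-! ### Existence of optimal filters and their dependence on the observations. -/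

section Optimal

lemma continuous_specNorm1 (n : ℕ) : Continuous (specNorm1 : (Fin (n + 1) → ℂ) → ℝ) := by
  unfold specNorm1 dft
  fun_prop

lemma continuous_norm2_sub_conv (n : ℕ) (y : ℤ → ℂ) :
    Continuous fun φ : Fin (n + 1) → ℂ => norm2 n (y - conv φ y) := by
  unfold norm2 conv
  simp only [Pi.sub_apply]
  fun_prop

lemma exists_isConstrainedOptimal (n : ℕ) {r : ℝ} (hr : 0 ≤ r) (y : ℤ → ℂ) :
    ∃ φ : Fin (n + 1) → ℂ, IsConstrainedOptimal n r y φ := by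
  set K : Set (Fin (n + 1) → ℂ) := {φ | specNorm1 φ ≤ r / Real.sqrt ((n : ℝ) + 1)} with hK
  have hclosed : IsClosed K := isClosed_le (continuous_specNorm1 n) continuous_const
  have hbdd : Bornology.IsBounded K := by
    refine Bornology.IsBounded.subset (Metric.isBounded_closedBall
      (x := 0) (r := r / Real.sqrt ((n : ℝ) + 1) / Real.sqrt ((n : ℝ) + 1))) fun φ hφ => ?_
    rw [mem_closedBall_zero_iff, pi_norm_le_iff_of_nonneg (by positivity)]
    exact fun j => (norm_apply_le_specNorm1 φ j).trans
      (div_le_div_of_nonneg_right hφ (Real.sqrt_nonneg _))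
  have h0 : (0 : Fin (n + 1) → ℂ) ∈ K := by
    have : specNorm1 (0 : Fin (n + 1) → ℂ) = 0 := by simp [specNorm1, dft]
    rw [hK, Set.mem_ofPred_eq, this]
    positivity
  obtain ⟨φ, hφ, hmin⟩ := (Metric.isCompact_of_isClosed_isBounded hclosed hbdd).exists_isMinOn
    ⟨0, h0⟩ (continuous_norm2_sub_conv n y).continuousOn
  exact ⟨φ, hφ, fun ψ hψ => hmin hψ⟩

lemma conv_congr {n : ℕ} (φ : Fin (n + 1) → ℂ) {y y' : ℤ → ℂ}
    (h : ∀ τ ∈ Set.Icc (-(n : ℤ)) n, y τ = y' τ) {t : ℤ} (h0 : 0 ≤ t) (hn : t ≤ n) :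
    conv φ y t = conv φ y' t := by
  refine Finset.sum_congr rfl fun j _ => ?_
  have := j.2
  rw [h _ ⟨by omega, by omega⟩]

lemma norm2_sub_conv_congr {n : ℕ} (φ : Fin (n + 1) → ℂ) {y y' : ℤ → ℂ}
    (h : ∀ τ ∈ Set.Icc (-(n : ℤ)) n, y τ = y' τ) :
    norm2 n (y - conv φ y) = norm2 n (y' - conv φ y') := by
  unfold norm2
  congr 1
  refine Finset.sum_congr rfl fun t ht => ?_
  have := Finset.mem_range.1 ht
  rw [Pi.sub_apply, Pi.sub_apply, conv_congr φ h (by omega) (by omega), h _ ⟨by omega, by omega⟩]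

/-- The objective on [0, n] reads y only on [-n, n]. The noise outside may therefore be replaced by
zero. -/
lemma IsConstrainedOptimal.congr {n : ℕ} {r : ℝ} {φ : Fin (n + 1) → ℂ} {y y' : ℤ → ℂ}
    (hφ : IsConstrainedOptimal n r y φ) (h : ∀ τ ∈ Set.Icc (-(n : ℤ)) n, y τ = y' τ) :
    IsConstrainedOptimal n r y' φ := by
  refine ⟨hφ.1, fun ψ hψ => ?_⟩
  rw [← norm2_sub_conv_congr φ h, ← norm2_sub_conv_congr ψ h]
  exact hφ.2 ψ hψ

end Optimal

/-! ### Transfer to the canonical Gaussian space, and consequences of simplicity. -/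

section Noise

variable {Ω : Type*} {n : ℕ} {ζ : ℤ → Ω → ℂ}

/-- The noise on `[-n, n]` as a random vector. -/
def noiseVec (n : ℕ) (ζ : ℤ → Ω → ℂ) (ω : Ω) : NoiseSpace n :=
  WithLp.toLp 2 fun i : Set.Icc (-(n : ℤ)) n => ζ i ω

lemma extendZero_noiseVec (ω : Ω) {τ : ℤ} (h : τ ∈ Set.Icc (-(n : ℤ)) n) :
    extendZero n (noiseVec n ζ ω) τ = ζ τ ω := by
  rw [extendZero_of_mem _ h]
  rfl

lemma obs_eq_add_extendZero (x : ℤ → ℂ) (σ : ℝ) (ω : Ω) {τ : ℤ} (h : τ ∈ Set.Icc (-(n : ℤ)) n) :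
    obs x σ ζ ω τ = (x + (σ : ℂ) • extendZero n (noiseVec n ζ ω)) τ := by
  rw [Pi.add_apply, Pi.smul_apply, extendZero_noiseVec ω h]
  rfl

variable [MeasurableSpace Ω] {μ : Measure Ω}

lemma IsNoise.measurable_noiseVec (h : IsNoise μ n ζ) : Measurable (noiseVec n ζ) :=
  (MeasurableEquiv.toLp 2 _).measurable.comp
    (measurable_pi_lambda _ fun i => h.measurable i i.2)

lemma IsNoise.map_noiseVec [IsProbabilityMeasure μ] (h : IsNoise μ n ζ) :
    μ.map (noiseVec n ζ) = stdGaussian (NoiseSpace n) := by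
  have hm : Measurable fun (ω : Ω) (i : Set.Icc (-(n : ℤ)) n) => ζ i ω :=
    measurable_pi_lambda _ fun i => h.measurable i i.2
  have h1 := (iIndepFun_iff_map_fun_eq_pi_map
    (fun i : Set.Icc (-(n : ℤ)) n => (h.measurable i i.2).aemeasurable)).1 h.indep
  simp_rw [fun i : Set.Icc (-(n : ℤ)) n => h.law i i.2] at h1
  rw [← map_pi_stdComplexGaussian, ← h1, Measure.map_map (by fun_prop) hm]
  rfl

/-- Bias–variance decomposition, with 2 = E|ζ|². Only this direction is needed, so it is enough that
the noise coefficients include those of φ. -/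
lemma IsNoise.integral_norm_sub_conv_sq [IsProbabilityMeasure μ] (h : IsNoise μ n ζ)
    (x : ℤ → ℂ) (σ : ℝ) {k : ℕ} (φ : Fin (k + 1) → ℂ) {τ : ℤ}
    (hτ : ∀ j : Fin (k + 1), τ - (j : ℕ) ∈ Set.Icc (-(n : ℤ)) n) :
    ‖x τ - conv φ x τ‖ ^ 2 + 2 * (σ ^ 2 * ∑ j, ‖φ j‖ ^ 2)
      ≤ ∫ ω, ‖x τ - conv φ (obs x σ ζ ω) τ‖ ^ 2 ∂μ := by
  let T : NoiseSpace n →ₗ[ℂ] ℂ := (LinearMap.proj τ).comp ((convₗ φ).comp (extendZero n))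
  have hT : ∀ z, T z = conv φ (extendZero n z) τ := fun _ => rfl
  have h1 : ∀ ω, ‖x τ - conv φ (obs x σ ζ ω) τ‖ ^ 2
      = ‖(x τ - conv φ x τ) + ∑ i, (-(σ : ℂ) * T (EuclideanSpace.single i 1)) *
          noiseVec n ζ ω i‖ ^ 2 := by
    intro ω
    have e : conv φ (obs x σ ζ ω) τ
        = conv φ (x + (σ : ℂ) • extendZero n (noiseVec n ζ ω)) τ :=
      Finset.sum_congr rfl fun j _ => by rw [obs_eq_add_extendZero x σ ω (hτ j)]
    rw [e, conv_add, conv_smul]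
    simp_rw [mul_assoc]
    rw [← Finset.mul_sum, ← linear_apply_eq_sum, hT]
    simp only [Pi.add_apply, Pi.smul_apply, smul_eq_mul]
    congr 2
    ring
  simp_rw [h1]
  rw [← integral_map (φ := noiseVec n ζ) h.measurable_noiseVec.aemeasurable
    (f := fun z : NoiseSpace n => ‖(x τ - conv φ x τ) +
      ∑ i, (-(σ : ℂ) * T (EuclideanSpace.single i 1)) * z i‖ ^ 2)
    (by
      have : Continuous fun z : NoiseSpace n => ‖(x τ - conv φ x τ) +
        ∑ i, (-(σ : ℂ) * T (EuclideanSpace.single i 1)) * z i‖ ^ 2 := by fun_prop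
      exact this.aestronglyMeasurable), h.map_noiseVec, integral_norm_sq_affine]
  have h2 : ∑ j, ‖φ j‖ ^ 2 ≤ ∑ i, ‖T (EuclideanSpace.single i 1)‖ ^ 2 := by
    have hinj : Function.Injective
        (fun j : Fin (k + 1) => (⟨τ - (j : ℕ), hτ j⟩ : Set.Icc (-(n : ℤ)) n)) := by
      intro a b hab
      have := congrArg Subtype.val hab
      simp only at this
      exact Fin.ext (by omega)
    have hsum := Finset.sum_le_univ_sum_of_nonneg
      (f := fun i : Set.Icc (-(n : ℤ)) n => ‖T (EuclideanSpace.single i 1)‖ ^ 2)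
      (s := Finset.univ.map ⟨_, hinj⟩) (fun t => sq_nonneg _)
    rw [Finset.sum_map] at hsum
    refine le_trans (le_of_eq (Finset.sum_congr rfl fun j _ => ?_)) hsum
    simp only [Function.Embedding.coeFn_mk]
    rw [hT, ← conv_extendZero_single φ ⟨τ - (j : ℕ), hτ j⟩ j]
    simp only [sub_add_cancel]
  simp_rw [norm_mul, mul_pow, norm_neg, Complex.norm_real, Real.norm_eq_abs, sq_abs]
  rw [← Finset.mul_sum]
  gcongr

lemma IsSimple.exists_filter [IsProbabilityMeasure μ] {m : ℕ} (h : IsNoise μ (2 * m) ζ)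
    {σ ρ : ℝ} (hσ : 0 < σ) (hρ : 0 ≤ ρ) {x : ℤ → ℂ} (hx : IsSimple μ ζ σ m ρ x) :
    ∃ φ : Fin (m + 1) → ℂ, ∑ j, ‖φ j‖ ^ 2 ≤ ρ ^ 2 / (2 * ((m : ℝ) + 1)) ∧
      ∀ τ ∈ Set.Icc (-(m : ℤ)) (2 * m),
        ‖x τ - conv φ x τ‖ ≤ σ * ρ / Real.sqrt ((m : ℝ) + 1) := by
  obtain ⟨φ, hφ⟩ := hx
  have hm : (0 : ℝ) < (m : ℝ) + 1 := by positivity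
  have key : ∀ τ ∈ Set.Icc (-(m : ℤ)) (2 * m),
      ‖x τ - conv φ x τ‖ ^ 2 + 2 * (σ ^ 2 * ∑ j, ‖φ j‖ ^ 2)
        ≤ (σ * ρ / Real.sqrt ((m : ℝ) + 1)) ^ 2 := by
    intro τ hτ
    refine (h.integral_norm_sub_conv_sq x σ φ fun j => ?_).trans
      (Real.sqrt_le_iff.1 (hφ τ hτ)).2
    have h1 := hτ.1
    have h2 := hτ.2
    have h3 := j.2
    exact ⟨by push_cast; omega, by push_cast; omega⟩
  have hs0 : 0 ≤ ∑ j, ‖φ j‖ ^ 2 := Finset.sum_nonneg fun _ _ => sq_nonneg _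
  refine ⟨φ, ?_, fun τ hτ => ?_⟩
  -- The variance does not depend on τ, so a single time is enough to bound ‖φ‖₂.
  · have h1 := key 0 ⟨by omega, by omega⟩
    rw [div_pow, Real.sq_sqrt hm.le, le_div_iff₀ hm] at h1
    rw [le_div_iff₀ (by positivity)]
    have h2 : 0 ≤ ‖x 0 - conv φ x 0‖ ^ 2 * ((m : ℝ) + 1) := by positivity
    have h3 : σ ^ 2 * ((∑ j, ‖φ j‖ ^ 2) * (2 * ((m : ℝ) + 1))) ≤ σ ^ 2 * ρ ^ 2 := by linarith
    exact le_of_mul_le_mul_left h3 (by positivity)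
  · refine abs_le_of_sq_le_sq' ?_ (by positivity) |>.2
    have h2 : 0 ≤ 2 * (σ ^ 2 * ∑ j, ‖φ j‖ ^ 2) := by positivity
    linarith [key τ hτ]

end Noise

/-! ### Correlations of the noise with fixed vectors. -/

section LinearEvents

variable {n : ℕ}

lemma exists_event_inner (v : EuclideanSpace ℂ (Fin (n + 1))) {c δ : ℝ} (hc : ‖v‖ ≤ c)
    (hδ : 0 < δ) :
    ∃ G : Set (NoiseSpace n), MeasurableSet G ∧ stdGaussian (NoiseSpace n) Gᶜ ≤ ENNReal.ofReal δ ∧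
      ∀ z ∈ G, ‖inner ℂ (res n (extendZero n z)) v‖ ^ 2 ≤ 4 * c ^ 2 * Real.log (2 / δ) := by
  let T : Unit → NoiseSpace n →L[ℝ] ℂ := fun _ =>
    toRealCLM ((innerₛₗ ℂ v).comp ((res n).comp (extendZero n)))
  have hT : ∀ j z, ‖T j z‖ = ‖inner ℂ (res n (extendZero n z)) v‖ := fun j z => by
    rw [norm_inner_symm]; rfl
  obtain ⟨G, hG, hGm, hGb⟩ := exists_event_sum_sq T ((norm_nonneg v).trans hc) (fun j z => by
    rw [hT j z, mul_comm]
    exact (norm_inner_le_norm _ _).trans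
      (mul_le_mul (norm_res_extendZero_le z) hc (norm_nonneg _) (norm_nonneg _))) hδ
  refine ⟨G, hG, hGm, fun z hz => ?_⟩
  have h := hGb z hz
  simpa [hT] using h

lemma exists_event_inner_orthogonal {κ : Type*} [Fintype κ] [Nonempty κ]
    (V : Submodule ℂ (EuclideanSpace ℂ (Fin (n + 1)))) (v : κ → EuclideanSpace ℂ (Fin (n + 1)))
    {c δ : ℝ} (hc0 : 0 ≤ c) (hc : ∀ j, ‖v j‖ ≤ c) (hδ : 0 < δ) :
    ∃ G : Set (NoiseSpace n), MeasurableSet G ∧ stdGaussian (NoiseSpace n) Gᶜ ≤ ENNReal.ofReal δ ∧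
      ∀ z ∈ G, ∑ j, ‖inner ℂ (res n (extendZero n z)
        - V.starProjection (res n (extendZero n z))) (v j)‖ ^ 2
          ≤ 4 * Fintype.card κ * c ^ 2 * Real.log (2 / δ) := by
  let T : κ → NoiseSpace n →L[ℝ] ℂ := fun j =>
    toRealCLM ((innerₛₗ ℂ (v j)).comp (Vᗮ.starProjection.toLinearMap.comp
      ((res n).comp (extendZero n))))
  have hT : ∀ j z, ‖T j z‖ = ‖inner ℂ (Vᗮ.starProjection (res n (extendZero n z))) (v j)‖ :=
    fun j z => by rw [norm_inner_symm]; rfl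
  obtain ⟨G, hG, hGm, hGb⟩ := exists_event_sum_sq T hc0 (fun j z => by
    rw [hT j z, mul_comm]
    exact (norm_inner_le_norm _ _).trans (mul_le_mul
      ((Vᗮ.norm_starProjection_apply_le _).trans (norm_res_extendZero_le z)) (hc j)
        (norm_nonneg _) (norm_nonneg _))) hδ
  refine ⟨G, hG, hGm, fun z hz => ?_⟩
  have h := hGb z hz
  simp_rw [hT] at h
  simpa only [Submodule.starProjection_orthogonal_val] using h

end LinearEvents

/-! ### Comparison of logarithms. -/

section Logarithms

lemma log_le_mul_log {X Y : ℝ} (hY : 0 < Y) (p : ℕ) (h : Y ≤ X ^ p) :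
    Real.log Y ≤ p * Real.log X := by
  rw [← Real.log_pow]
  exact Real.log_le_log hY h

/-- Absorbs numerical constants into powers of X, which is n/α or max(1/α, 2) below; after taking
logarithms they become a multiplicative factor. -/
lemma mul_pow_le_pow {X : ℝ} (hX : 2 ≤ X) (a b : ℕ) : 2 ^ a * X ^ b ≤ X ^ (a + b) := by
  rw [pow_add]
  gcongr

lemma nat_add_one_div_le {n : ℕ} (hn : 2 ≤ n) {α : ℝ} (hα : 0 < α) :
    ((n : ℝ) + 1) / α ≤ 2 * (n / α) := by
  have : (2 : ℝ) ≤ n := by exact_mod_cast hn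
  rw [mul_div_assoc']
  gcongr
  linarith

lemma two_le_nat_div {n : ℕ} (hn : 2 ≤ n) {α : ℝ} (hα : 0 < α) (hα1 : α ≤ 1) :
    2 ≤ (n : ℝ) / α := by
  have : (2 : ℝ) ≤ n := by exact_mod_cast hn
  rw [le_div_iff₀ hα]
  linarith

lemma one_div_le_nat_div {n : ℕ} (hn : 2 ≤ n) {α : ℝ} (hα : 0 < α) :
    2 / α ≤ (n : ℝ) / α := by
  have : (2 : ℝ) ≤ n := by exact_mod_cast hn
  gcongr

variable {n : ℕ} {α : ℝ}

lemma log_conv_event_le (hn : 2 ≤ n) (hα : 0 < α) (hα1 : α ≤ 1) :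
    Real.log (((n : ℝ) + 1) ^ 2 * 2 / (α / 6)) ≤ 8 * Real.log (n / α) := by
  refine log_le_mul_log (by positivity) 8 ?_
  have h1 := nat_add_one_div_le hn hα
  have hX := two_le_nat_div hn hα hα1
  set X := (n : ℝ) / α
  have e : ((n : ℝ) + 1) ^ 2 * 2 / (α / 6) = 12 * α * (((n : ℝ) + 1) / α) ^ 2 := by
    field_simp; norm_num
  rw [e]
  calc 12 * α * (((n : ℝ) + 1) / α) ^ 2 ≤ 12 * 1 * (2 * X) ^ 2 := by gcongr
    _ ≤ 2 ^ 6 * X ^ 2 := by nlinarith [sq_nonneg X]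
    _ ≤ X ^ 8 := mul_pow_le_pow hX 6 2

lemma log_quadratic_event_le (hn : 2 ≤ n) (hα : 0 < α) (hα1 : α ≤ 1) :
    Real.log (((n : ℝ) + 1) * 4 * (2 * Real.exp 1) / (α / 6)) ≤ 10 * Real.log (n / α) := by
  refine log_le_mul_log (by positivity) 10 ?_
  have h1 := nat_add_one_div_le hn hα
  have hX := two_le_nat_div hn hα hα1
  set X := (n : ℝ) / α
  have e : ((n : ℝ) + 1) * 4 * (2 * Real.exp 1) / (α / 6)
      = 48 * Real.exp 1 * (((n : ℝ) + 1) / α) := by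
    field_simp; norm_num
  have he : Real.exp 1 ≤ 3 := by linarith [Real.exp_one_lt_d9]
  rw [e]
  calc 48 * Real.exp 1 * (((n : ℝ) + 1) / α) ≤ 48 * 3 * (2 * X) := by gcongr
    _ ≤ 2 ^ 9 * X ^ 1 := by nlinarith
    _ ≤ X ^ 10 := mul_pow_le_pow hX 9 1

lemma log_projection_event_le (hn : 2 ≤ n) (hα : 0 < α) (hα1 : α ≤ 1) {d s : ℕ} (hd : d ≤ s) :
    Real.log (2 ^ d / (α / 6)) ≤ s + 3 * Real.log (n / α) := by
  have hX := two_le_nat_div hn hα hα1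
  have h2 := one_div_le_nat_div hn hα
  have h3 : Real.log (6 / α) ≤ (3 : ℕ) * Real.log (n / α) := by
    refine log_le_mul_log (by positivity) 3 ?_
    set X := (n : ℝ) / α
    have e : 6 / α = 3 * (2 / α) := by ring
    calc 6 / α ≤ 3 * X := by rw [e]; gcongr
      _ ≤ 2 ^ 2 * X ^ 1 := by nlinarith
      _ ≤ X ^ 3 := mul_pow_le_pow hX 2 1
  have e : (2 : ℝ) ^ d / (α / 6) = 2 ^ d * (6 / α) := by field_simp
  rw [e, Real.log_mul (by positivity) (by positivity), Real.log_pow]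
  have hds : (d : ℝ) ≤ s := by exact_mod_cast hd
  have hl : Real.log 2 ≤ 1 := by linarith [Real.log_two_lt_d9]
  have hl0 : 0 ≤ Real.log 2 := Real.log_nonneg (by norm_num)
  have : (d : ℝ) * Real.log 2 ≤ s := by
    calc (d : ℝ) * Real.log 2 ≤ s * 1 := by gcongr
      _ = s := mul_one _
  push_cast at h3
  linarith

lemma log_linear_event_le (hn : 2 ≤ n) (hα : 0 < α) (hα1 : α ≤ 1) :
    Real.log (2 / (α / 6)) ≤ 5 * Real.log (n / α) := by
  refine log_le_mul_log (by positivity) 5 ?_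
  have hX := two_le_nat_div hn hα hα1
  have h2 := one_div_le_nat_div hn hα
  set X := (n : ℝ) / α
  have e : 2 / (α / 6) = 6 * (2 / α) := by field_simp
  calc 2 / (α / 6) ≤ 6 * X := by rw [e]; gcongr
    _ ≤ 2 ^ 4 * X ^ 1 := by nlinarith
    _ ≤ X ^ 5 := mul_pow_le_pow hX 4 1

lemma log_linear_event_le_max (hα : 0 < α) :
    Real.log (2 / (α / 6)) ≤ 5 * Real.log (max (1 / α) 2) := by
  refine log_le_mul_log (by positivity) 5 ?_
  have hX : 2 ≤ max (1 / α) 2 := le_max_right _ _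
  have h2 : 1 / α ≤ max (1 / α) 2 := le_max_left _ _
  set X := max (1 / α) 2
  have e : 2 / (α / 6) = 12 * (1 / α) := by field_simp; norm_num
  calc 2 / (α / 6) ≤ 12 * X := by rw [e]; gcongr
    _ ≤ 2 ^ 4 * X ^ 1 := by nlinarith
    _ ≤ X ^ 5 := mul_pow_le_pow hX 4 1

end Logarithms

/-! ### Intersection of the events and the final bound. -/

section RiskBound

lemma measure_compl_inter_le {Ω : Type*} [MeasurableSpace Ω] {μ : Measure Ω} {G H : Set Ω}
    {a b : ℝ} (ha : 0 ≤ a) (hb : 0 ≤ b) (hG : μ Gᶜ ≤ ENNReal.ofReal a)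
    (hH : μ Hᶜ ≤ ENNReal.ofReal b) : μ (G ∩ H)ᶜ ≤ ENNReal.ofReal (a + b) := by
  rw [Set.compl_inter, ENNReal.ofReal_add ha hb]
  exact (measure_union_le _ _).trans (add_le_add hG hH)

/-- The quantity in brackets in the risk bound. -/
def riskFactor (n s : ℕ) (ρ ϰ α : ℝ) : ℝ :=
  ρ ^ 2 * Real.sqrt (Real.log ((n : ℝ) / α)) +
    ρ * Real.sqrt (ϰ * Real.sqrt (Real.log (max (1 / α) 2))) + Real.sqrt (s : ℝ)

lemma riskFactor_bounds {n s : ℕ} {ρ ϰ α : ℝ} (hn : 2 ≤ n) (hα : 0 < α) (hα1 : α ≤ 1)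
    (hρ : 1 ≤ ρ) (hϰ : 0 ≤ ϰ) :
    0 ≤ riskFactor n s ρ ϰ α ∧
    ρ ^ 2 * Real.sqrt (Real.log ((n : ℝ) / α)) ≤ riskFactor n s ρ ϰ α ∧
    ρ ^ 2 ≤ 4 / 3 * riskFactor n s ρ ϰ α ∧
    ρ ^ 2 * (ϰ * Real.sqrt (Real.log (max (1 / α) 2))) ≤ riskFactor n s ρ ϰ α ^ 2 ∧
    (s : ℝ) + Real.log ((n : ℝ) / α) ≤ riskFactor n s ρ ϰ α ^ 2 := by
  have hX := two_le_nat_div hn hα hα1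
  have hL0 : Real.log 2 ≤ Real.log ((n : ℝ) / α) := Real.log_le_log (by norm_num) hX
  -- ln 2 > 9/16; this is the origin of the factor 4/3 in the bound on ρ².
  have hL1 : (3 / 4) ^ 2 ≤ Real.log ((n : ℝ) / α) := by
    have := Real.log_two_gt_d9
    linarith
  unfold riskFactor
  set L := Real.log ((n : ℝ) / α)
  set B := ϰ * Real.sqrt (Real.log (max (1 / α) 2)) with hB
  have hB0 : 0 ≤ B := by positivity
  have h34 : 3 / 4 ≤ Real.sqrt L := Real.le_sqrt_of_sq_le hL1
  have hρ1 : (1 : ℝ) ≤ ρ ^ 2 := one_le_pow₀ hρ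
  have hp : 0 ≤ ρ ^ 2 * Real.sqrt L := by positivity
  have hq : 0 ≤ ρ * Real.sqrt B := by positivity
  have hr : 0 ≤ Real.sqrt (s : ℝ) := Real.sqrt_nonneg _
  have hr2 : Real.sqrt (s : ℝ) ^ 2 = s := Real.sq_sqrt (Nat.cast_nonneg s)
  have hq2 : (ρ * Real.sqrt B) ^ 2 = ρ ^ 2 * B := by rw [mul_pow, Real.sq_sqrt hB0]
  have hp2 : L ≤ (ρ ^ 2 * Real.sqrt L) ^ 2 := by
    rw [mul_pow, Real.sq_sqrt (by linarith)]
    exact le_mul_of_one_le_left (by linarith) (one_le_pow₀ hρ1)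
  refine ⟨by linarith, by linarith, ?_, ?_, ?_⟩
  · have := mul_le_mul_of_nonneg_left h34 (by linarith : 0 ≤ ρ ^ 2)
    linarith
  · rw [← hq2]
    exact pow_le_pow_left₀ hq (by linarith) 2
  · have h1 := mul_nonneg hp hq
    have h2 := mul_nonneg hp hr
    have h3 := mul_nonneg hq hr
    have h4 := sq_nonneg (ρ * Real.sqrt B)
    nlinarith

/-- The risk bound on the canonical space of noise realizations. -/
lemma exists_event_risk_bound {m s : ℕ} (hm : 1 ≤ m) {σ ρ ϰ α : ℝ} (hσ : 0 < σ) (hρ : 1 ≤ ρ)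
    (hα : 0 < α) (hα1 : α ≤ 1) {x : ℤ → ℂ} (hA : AssumptionA (2 * m) s σ ϰ x)
    (φ : Fin (m + 1) → ℂ) (hφ : ∑ j, ‖φ j‖ ^ 2 ≤ ρ ^ 2 / (2 * ((m : ℝ) + 1)))
    (hb : ∀ τ ∈ Set.Icc (-(m : ℤ)) (2 * m),
      ‖x τ - conv φ x τ‖ ≤ σ * ρ / Real.sqrt ((m : ℝ) + 1)) :
    ∃ G : Set (NoiseSpace (2 * m)), MeasurableSet G ∧
      stdGaussian (NoiseSpace (2 * m)) Gᶜ ≤ ENNReal.ofReal α ∧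
      ∀ z ∈ G, ∀ ψ : Fin (2 * m + 1) → ℂ,
        IsConstrainedOptimal (2 * m) (2 * ρ ^ 2) (x + (σ : ℂ) • extendZero (2 * m) z) ψ →
        ‖x ((2 * m : ℕ) : ℤ) - conv ψ (x + (σ : ℂ) • extendZero (2 * m) z) ((2 * m : ℕ) : ℤ)‖
          ≤ 80 * (σ * ρ / Real.sqrt ((m : ℝ) + 1)) * riskFactor (2 * m) s ρ ϰ α := by
  obtain ⟨hs1, -, S, hS, hrank, xS, hxS, ε, hx, hε⟩ := hA
  have hn : 2 ≤ 2 * m := by omega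
  have hε' : ∀ j : Fin (2 * m + 1), ‖res (2 * m) ((shift ^ (j : ℕ)) ε)‖ ≤ σ * ϰ := fun j => by
    rw [norm_res]
    exact hε j (Nat.lt_succ_iff.1 j.2)
  have hσϰ : 0 ≤ σ * ϰ := (norm_nonneg _).trans (hε' 0)
  have hϰ : 0 ≤ ϰ := nonneg_of_mul_nonneg_right hσϰ hσ
  -- s ≥ 1 rules out the default value 0 that `finrank` takes on infinite-dimensional spaces.
  have hfin : FiniteDimensional ℂ S := Module.finite_of_finrank_pos (by omega)
  set V := S.map (res (2 * m)) with hV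
  have hVs : Module.finrank ℂ V ≤ s := (Submodule.finrank_map_le _ _).trans hrank.le
  have hδ : 0 < α / 6 := by positivity
  obtain ⟨hQ0, hQL, hQρ, hQϰ, hQs⟩ := riskFactor_bounds (s := s) hn hα hα1 hρ hϰ
  have l1 := log_conv_event_le hn hα hα1
  have l2 := log_quadratic_event_le hn hα hα1
  have l3 := log_projection_event_le hn hα hα1 hVs
  have l4 := log_linear_event_le hn hα hα1
  have l5 := log_linear_event_le_max hα
  set Q := riskFactor (2 * m) s ρ ϰ α
  set L := Real.log (((2 * m : ℕ) : ℝ) / α) with hL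
  set L' := Real.log (max (1 / α) 2) with hL'
  have hL0 : 0 ≤ L := Real.log_nonneg (by linarith [two_le_nat_div hn hα hα1])
  have hL'0 : 0 ≤ L' := Real.log_nonneg (by linarith [le_max_right (1 / α) 2])
  obtain ⟨G1, m1, p1, g1⟩ := exists_event_conv_atom (2 * m) hδ
  obtain ⟨G2, m2, p2, g2⟩ := exists_event_quadratic_atom (2 * m) hδ
  obtain ⟨G3, m3, p3, g3⟩ := exists_event_projection V hδ
  obtain ⟨G4, m4, p4, g4⟩ := exists_event_inner _ (norm_res_sub_convSq_le x φ hσ hρ hφ hb) hδ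
  obtain ⟨G5, m5, p5, g5⟩ := exists_event_inner_orthogonal (κ := Unit) V
    (fun _ => res (2 * m) ε) hσϰ (fun _ => by simpa using hε' 0) hδ
  obtain ⟨G6, m6, p6, g6⟩ := exists_event_inner_orthogonal V
    (fun j : Fin (2 * m + 1) => res (2 * m) ((shift ^ (j : ℕ)) ε)) hσϰ hε' hδ
  refine ⟨G1 ∩ (G2 ∩ (G3 ∩ (G4 ∩ (G5 ∩ G6)))), by measurability, ?_, ?_⟩
  · have h := measure_compl_inter_le hδ.le (by positivity) p1 (measure_compl_inter_le hδ.le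
      (by positivity) p2 (measure_compl_inter_le hδ.le (by positivity) p3
        (measure_compl_inter_le hδ.le (by positivity) p4
          (measure_compl_inter_le hδ.le hδ.le p5 p6))))
    refine h.trans (ENNReal.ofReal_le_ofReal (by linarith))
  rintro z ⟨z1, z2, z3, z4, z5, z6⟩ ψ hψ
  have hsqL : Real.sqrt L ^ 2 = L := Real.sq_sqrt hL0
  have hsqL' : Real.sqrt L' ^ 2 = L' := Real.sq_sqrt hL'0
  refine norm_error_le_of_good_noise x xS ε _ S hS hxS hx hV hσ hρ hϰ hL0 hQ0 hQL hQρ hQϰ φ hφ hb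
    ?_ ?_ ?_ ?_ ?_ ?_ ψ hψ
  -- Constants in the six bounds: 4·8 ≤ 6²; 2·(57/20)·10 = 57; 4(s + 3L) ≤ 4²(s + L); 4·3²·5 ≤ 14²;
  -- and 4·5 ≤ 5² for the last two.
  · intro k t
    refine abs_le_of_sq_le_sq' ?_ (by positivity) |>.2
    rw [mul_pow, hsqL]
    linarith [g1 z z1 k t]
  · intro k
    refine (g2 z z2 k).trans ?_
    have h8 : Real.sqrt 8 ≤ 57 / 20 := Real.sqrt_le_iff.2 ⟨by norm_num, by norm_num⟩
    rw [Real.sqrt_mul (by norm_num)]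
    calc _ ≤ 2 * (Real.sqrt 8 * Real.sqrt (((2 * m : ℕ) : ℝ) + 1) * (10 * L)) := by gcongr
      _ ≤ 2 * (57 / 20 * Real.sqrt (((2 * m : ℕ) : ℝ) + 1) * (10 * L)) := by gcongr
      _ = _ := by ring
  · refine abs_le_of_sq_le_sq' ?_ (by positivity) |>.2
    refine (g3 z z3).trans ?_
    have : (0 : ℝ) ≤ s := Nat.cast_nonneg s
    rw [mul_pow]
    linarith
  · refine abs_le_of_sq_le_sq' ?_ (by positivity) |>.2
    refine (g4 z z4).trans ?_
    rw [mul_pow _ (Real.sqrt L), hsqL]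
    have h := mul_le_mul_of_nonneg_left l4 (by positivity : 0 ≤ 4 * (3 * σ * ρ ^ 2) ^ 2)
    refine h.trans ?_
    have : 0 ≤ (σ * ρ ^ 2) ^ 2 * L := by positivity
    linarith
  · refine abs_le_of_sq_le_sq' ?_ (by positivity) |>.2
    have h5 := g5 z z5
    simp only [Finset.univ_unique, Finset.sum_singleton, Fintype.card_unit, Nat.cast_one,
      mul_one] at h5
    refine h5.trans ?_
    rw [mul_pow _ (Real.sqrt L'), hsqL']
    refine (mul_le_mul_of_nonneg_left l5 (by positivity)).trans ?_
    have : 0 ≤ (σ * ϰ) ^ 2 * L' := by positivity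
    linarith
  · have h6 := g6 z z6
    rw [Fintype.card_fin] at h6
    refine h6.trans ?_
    rw [mul_pow _ (Real.sqrt L'), hsqL']
    refine (mul_le_mul_of_nonneg_left l5 (by positivity)).trans ?_
    have : 0 ≤ (((2 * m : ℕ) : ℝ) + 1) * ((σ * ϰ) ^ 2 * L') := by positivity
    push_cast at this ⊢
    linarith

end RiskBound

end FilterRecovery

end

theorem mainTheorem3 :
    ∃ C : ℝ, 0 < C ∧
      ∀ (Ω : Type*) (_ : MeasurableSpace Ω) (μ : Measure Ω) (_ : IsProbabilityMeasure μ)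
        (m n s : ℕ) (σ ρ ϰ α : ℝ) (x : ℤ → ℂ) (ζ : ℤ → Ω → ℂ),
        1 ≤ m → n = 2 * m → 0 < σ → 1 ≤ ρ →
        FilterRecovery.IsNoise μ n ζ →
        FilterRecovery.IsSimple μ ζ σ m ρ x →
        FilterRecovery.AssumptionA n s σ ϰ x →
        0 < α → α ≤ 1 →
        (∀ ω, ∃ φ : Fin (n + 1) → ℂ, FilterRecovery.IsConstrainedOptimal n (2 * ρ ^ 2)
            (FilterRecovery.obs x σ ζ ω) φ) ∧
        ∃ E : Set Ω, MeasurableSet E ∧ ENNReal.ofReal (1 - α) ≤ μ E ∧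
          ∀ ω ∈ E, ∀ φ : Fin (n + 1) → ℂ,
            FilterRecovery.IsConstrainedOptimal n (2 * ρ ^ 2)
              (FilterRecovery.obs x σ ζ ω) φ →
            ‖x n - FilterRecovery.conv φ (FilterRecovery.obs x σ ζ ω) n‖ ≤
              C * (σ * ρ / Real.sqrt ((m : ℝ) + 1)) *
                (ρ ^ 2 * Real.sqrt (Real.log ((n : ℝ) / α)) +
                  ρ * Real.sqrt (ϰ * Real.sqrt (Real.log (max (1 / α) 2))) +
                  Real.sqrt (s : ℝ)) := by
  refine ⟨80, by norm_num, ?_⟩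
  intro Ω _ μ _ m n s σ ρ ϰ α x ζ hm hn hσ hρ hζ hx hA hα hα1
  subst hn
  refine ⟨fun ω => FilterRecovery.exists_isConstrainedOptimal _ (by positivity) _, ?_⟩
  obtain ⟨φ, hφ, hb⟩ := hx.exists_filter hζ hσ (by linarith)
  obtain ⟨G, hG, hGm, hGb⟩ :=
    FilterRecovery.exists_event_risk_bound hm hσ hρ hα hα1 hA φ hφ hb
  have hmeas := hζ.measurable_noiseVec hG
  refine ⟨FilterRecovery.noiseVec (2 * m) ζ ⁻¹' G, hmeas, ?_, ?_⟩
  · rw [← Measure.map_apply hζ.measurable_noiseVec hG, hζ.map_noiseVec,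
      ← compl_compl G, prob_compl_eq_one_sub hG.compl, ENNReal.ofReal_sub _ hα.le,
      ENNReal.ofReal_one]
    exact tsub_le_tsub_left hGm 1
  · intro ω hω ψ hψ
    have hobs : ∀ τ ∈ Set.Icc (-((2 * m : ℕ) : ℤ)) ((2 * m : ℕ) : ℤ),
        FilterRecovery.obs x σ ζ ω τ = (x + (σ : ℂ) • FilterRecovery.extendZero (2 * m)
          (FilterRecovery.noiseVec (2 * m) ζ ω)) τ :=
      fun τ hτ => FilterRecovery.obs_eq_add_extendZero x σ ω hτ
    rw [FilterRecovery.conv_congr ψ hobs (Int.natCast_nonneg _) le_rfl]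
    exact hGb _ hω ψ (hψ.congr hobs)
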